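/- **Setting.** Let $(X,d)$ be a complete separable metric space and $\kappa\colon X\to(0,\infty)$ bounded and continuous. For $f\colon X\to[-\infty,\infty)$ put $\|f\|_\kappa:=\sup_{x}|f(x)|\kappa(x)\in[0,\infty]$. Let $C_\kappa$ be the space of continuous $f\colon X\to\mathbb R$ with $\|f\|_\kappa<\infty$, and $U_\kappa$ the set of upper semicontinuous $f\colon X\to[-\infty,\infty)$ with $\|f^+\|_\kappa<\infty$; functions are ordered pointwise, and $f_n\downarrow f$ means pointwise decreasing convergence. The mixed topology on $C_\kappa$ is the strongest locally convex topology that coincides on $\|\cdot\|_\kappa$-bounded sets with the topology of uniform convergence on compact sets. For sequences put $(\Gamma\text{-}\limsup_n f_n)(x):=\sup\{\limsup_n f_n(x_n): x_n\to x\}$, and for families let $\Gamma\text{-}\limsup_{s\to t}f_s$ (respectively $h\downarrow0$) be the pointwise supremum of $\Gamma\text{-}\limsup_n f_{s_n}$ over all sequences $s_n\to t$ in $[0,\infty)$ (respectively $h_n\to0$, $h_n>0$). Let $S=(S(t))_{t\ge0}$ and $T=(T(t))_{t\ge0}$ be families of operators $C_\kappa\to U_\kappa$, each satisfying the following conditions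 (stated for $S$): * (S1) $S(t)$ is convex and monotone (pointwise in $x$) with $S(t)0=0$ for all $t\ge 0$; * (S2) $S(t)f_n\downarrow S(t)f$ whenever $t\ge0$ and $f_n\downarrow f$ in $C_\kappa$; * (S3) $\Gamma\text{-}\limsup_{s\to t}S(s)f\le S(t)f$ and $S(0)f=f$ for all $t\ge0$, $f\in C_\kappa$; * (S4) $\sup_{s\in[0,t]}\sup_{f\in C_\kappa,\,\|f\|_\kappa\le r}\|S(s)f\|_\kappa<\infty$ for all $r,t\ge0$. The Lipschitz set $\mathcal L^S$ (respectively the upper Lipschitz set $\mathcal L^S_+$) consists of all $f\in C_\kappa$ such that $S(t)f\in C_\kappa$ and $S(s+t)f=S(s)S(t)f$ for all $s,t\ge0$ and such that there are $h_0>0$, $c\ge0$ with $\|S(h)f-f\|_\kappa\le ch$ (respectively $\|(S(h)f-f)^+\|_\kappa\le ch$) for all $h\in[0,h_0]$. The upper $\Gamma$-generator is $A^+_\Gamma f:=\Gamma\text{-}\limsup_{h\downarrow0}\frac{S(h)f-f}{h}$ for $f\in\mathcal L^S_+$. The domain $D(A)$ of the generator of $S$ consists of all $f\in C_\kappa$ such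 that $S(t)f\in C_\kappa$ and $S(s+t)f=S(s)S(t)f$ for all $s,t\ge0$ and such that $\lim_{h\downarrow0}\frac{S(h)f-f}{h}$ exists in $C_\kappa$ with respect to the mixed topology. The analogous objects for $T$ are $\mathcal L^T$, $\mathcal L^T_+$, $B^+_\Gamma$ and $D(B)$. **Theorem.** 1. (Comparison) Let $\mathcal D\subset\mathcal L^T\cap\mathcal L^S_+$ be a set with $T(t)\colon\mathcal D\to\mathcal D$ for all $t\ge0$ and $A^+_\Gamma f\le B^+_\Gamma f$ for all $f\in\mathcal D$. Then $S(t)f\le T(t)f$ for all $t\ge0$ and all $f\in\mathcal D\cap D(B)$. 2. (Uniqueness) Suppose that $\mathcal L^T\subset\mathcal L^S_+$, $\mathcal L^S\subset\mathcal L^T_+$ and $A^+_\Gamma f=B^+_\Gamma f$ for all $f\in\mathcal L^S\cup\mathcal L^T$ (for instance, that $\mathcal L^S_+=\mathcal L^T_+$ and $A^+_\Gamma=B^+_\Gamma$ there, or that $\mathcal L^S=\mathcal L^T$ and $A^+_\Gamma=B^+_\Gamma$ there). Then $S(t)f=T(t)f$ for all $t\ge0$ and all $f\in D(A)\cap D(B)$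 and, more generally, for all $t\ge 0$ and every $f\in C_\kappa$ that is the limit in the mixed topology of a sequence in $D(A)\cap D(B)$. -/

import Mathlib

open Filter Topology
open scoped NNReal ENNReal

namespace ConvexMonotone

variable {X : Type*}

/-- The weighted norm `sup_x |f x| κ(x)` with values in `[0, ∞]`, for extended real valued `f`
(`|-∞| = ∞`). -/
noncomputable def normK (κ : X → ℝ) (f : X → EReal) : ℝ≥0∞ :=
  ⨆ x, (f x).abs * ENNReal.ofReal (κ x)

/-- A real function, viewed as an extended real valued one. -/
def toE (f : X → ℝ) : X → EReal := fun x => (f x : EReal)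

theorem normK_zero (κ : X → ℝ) : normK κ (toE (0 : X → ℝ)) = 0 := by
  simp [normK, toE]

theorem normK_add_le (κ f g : X → ℝ) :
    normK κ (toE (f + g)) ≤ normK κ (toE f) + normK κ (toE g) := by
  refine iSup_le fun x => ?_
  refine le_trans ?_ (add_le_add (le_iSup (fun x => (toE f x).abs * ENNReal.ofReal (κ x)) x)
    (le_iSup (fun x => (toE g x).abs * ENNReal.ofReal (κ x)) x))
  simp only [toE, EReal.abs_def, Pi.add_apply]
  rw [← add_mul, ← ENNReal.ofReal_add (abs_nonneg _) (abs_nonneg _)]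
  gcongr
  exact abs_add_le _ _

theorem normK_smul (κ : X → ℝ) (c : ℝ) (f : X → ℝ) :
    normK κ (toE (c • f)) = ENNReal.ofReal |c| * normK κ (toE f) := by
  simp only [normK, toE, EReal.abs_def, Pi.smul_apply, smul_eq_mul, ENNReal.mul_iSup]
  refine iSup_congr fun x => ?_
  rw [abs_mul, ENNReal.ofReal_mul (abs_nonneg _), mul_assoc]

section Spaces

variable [TopologicalSpace X]

/-- The space `C_κ` of continuous real functions with finite weighted norm. -/
def CK (κ : X → ℝ) : Submodule ℝ C(X, ℝ) where
  carrier := {f | normK κ (toE f) < ⊤}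
  add_mem' {f g} hf hg := lt_of_le_of_lt (normK_add_le κ f g) (ENNReal.add_lt_top.2 ⟨hf, hg⟩)
  zero_mem' := by
    have h := normK_zero κ
    change normK κ (toE (0 : X → ℝ)) < ⊤
    rw [h]
    exact ENNReal.zero_lt_top
  smul_mem' c f hf := by
    change normK κ (toE (c • (f : X → ℝ))) < ⊤
    rw [normK_smul]
    exact ENNReal.mul_lt_top ENNReal.ofReal_lt_top hf

/-- An element of `C_κ` as an extended real valued function. -/
def ckFn {κ : X → ℝ} (f : CK κ) : X → EReal := toE (f : C(X, ℝ))

/-- The set `U_κ` of upper semicontinuous `f : X → [-∞, ∞)` whose positive part has finite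
weighted norm. -/
def UK (κ : X → ℝ) : Set (X → EReal) :=
  {f | UpperSemicontinuous f ∧ (∀ x, f x ≠ ⊤) ∧ normK κ (fun x => max (f x) 0) < ⊤}

/-- The closed ball of radius `r` in `C_κ` for the weighted norm. -/
def ballK (κ : X → ℝ) (r : ℝ≥0) : Set (CK κ) := {f | normK κ (ckFn f) ≤ r}

/-- The topology of uniform convergence on compact sets, on `C_κ`. -/
@[reducible] def compactTopology (κ : X → ℝ) : TopologicalSpace (CK κ) :=
  TopologicalSpace.induced Subtype.val (ContinuousMap.compactOpen : TopologicalSpace C(X, ℝ))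

/-- `τ` is a locally convex vector space topology on `C_κ` that coincides on norm bounded sets
with the topology of uniform convergence on compact sets. -/
structure IsMixedCompatible (κ : X → ℝ) (τ : TopologicalSpace (CK κ)) : Prop where
  addGroup : @IsTopologicalAddGroup (CK κ) τ _
  smul : @ContinuousSMul ℝ (CK κ) _ _ τ
  locallyConvex : @LocallyConvexSpace ℝ (CK κ) _ _ _ _ τ
  eq_on_balls : ∀ r : ℝ≥0,
    TopologicalSpace.induced (Subtype.val : ballK κ r → CK κ) τ =
      TopologicalSpace.induced (Subtype.val : ballK κ r → CK κ) (compactTopology κ)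

/-- The mixed topology on `C_κ`: the strongest locally convex topology that coincides on norm
bounded sets with the topology of uniform convergence on compact sets. (In Mathlib's order on
topologies, finer means smaller.) -/
@[reducible] def mixedTopology (κ : X → ℝ) : TopologicalSpace (CK κ) :=
  sInf {τ | IsMixedCompatible κ τ}

/-- Convergence in `C_κ` with respect to the mixed topology. -/
def MixedTendsto {κ : X → ℝ} {ι : Type*} (F : ι → CK κ) (l : Filter ι) (f : CK κ) : Prop :=
  Tendsto F l (@nhds (CK κ) (mixedTopology κ) f)

/-- The `Γ`-limit superior of a sequence of functions. -/
noncomputable def gammaLimsupSeq (f : ℕ → X → EReal) (x : X) : EReal :=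
  sSup {a | ∃ u : ℕ → X, Tendsto u atTop (𝓝 x) ∧ a = limsup (fun n => f n (u n)) atTop}

/-- The `Γ`-limit superior of a family `(f s)` indexed by `s ≥ 0`: the pointwise supremum of the
`Γ`-limits superior along all sequences of indices tending to `l`. Here `l = 𝓝 t` expresses
`s → t`, and `l = 𝓝[>] 0` expresses `s ↓ 0`. -/
noncomputable def gammaLimsup (l : Filter ℝ≥0) (f : ℝ≥0 → X → EReal) (x : X) : EReal :=
  sSup {a | ∃ s : ℕ → ℝ≥0, Tendsto s atTop l ∧ a = gammaLimsupSeq (fun n => f (s n)) x}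

/-- `f n` decreases pointwise to `g`. -/
def DecreasesTo (f : ℕ → X → EReal) (g : X → EReal) : Prop :=
  Antitone f ∧ ∀ x, Tendsto (fun n => f n x) atTop (𝓝 (g x))

/-- The conditions on a family of operators `S(t) : C_κ → U_κ`, `t ≥ 0`. -/
structure IsConvexMonotoneFamily (κ : X → ℝ) (S : ℝ≥0 → CK κ → UK κ) : Prop where
  convex : ∀ (t : ℝ≥0) (f g : CK κ) (a : ℝ), 0 ≤ a → a ≤ 1 → ∀ x,
    (S t (a • f + (1 - a) • g)).1 x ≤
      (a : EReal) * (S t f).1 x + ((1 - a : ℝ) : EReal) * (S t g).1 x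
  monotone : ∀ (t : ℝ≥0) (f g : CK κ), ckFn f ≤ ckFn g → (S t f).1 ≤ (S t g).1
  map_zero : ∀ t, (S t 0).1 = 0
  continuous_above : ∀ (t : ℝ≥0) (F : ℕ → CK κ) (f : CK κ),
    DecreasesTo (fun n => ckFn (F n)) (ckFn f) → DecreasesTo (fun n => (S t (F n)).1) (S t f).1
  gamma_usc : ∀ (t : ℝ≥0) (f : CK κ), gammaLimsup (𝓝 t) (fun s => (S s f).1) ≤ (S t f).1
  initial : ∀ f : CK κ, (S 0 f).1 = ckFn f
  bounded : ∀ r t : ℝ≥0, (⨆ s ∈ Set.Icc 0 t, ⨆ f ∈ ballK κ r, normK κ (S s f).1) < ⊤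

/-- `u : t ↦ S(t) f` stays in `C_κ`, and `S(s + t) f = S(s) S(t) f` for all `s, t ≥ 0`. -/
def IsOrbit {κ : X → ℝ} (S : ℝ≥0 → CK κ → UK κ) (f : CK κ) (u : ℝ≥0 → CK κ) : Prop :=
  (∀ t, (S t f).1 = ckFn (u t)) ∧ ∀ s t, S (s + t) f = S s (u t)

/-- The increment `S(h) f - f`. -/
noncomputable def increment {κ : X → ℝ} (S : ℝ≥0 → CK κ → UK κ) (f : CK κ) (h : ℝ≥0) :
    X → EReal :=
  fun x => (S h f).1 x - ckFn f x

/-- The Lipschitz set of `S`. -/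
def lipschitzSet {κ : X → ℝ} (S : ℝ≥0 → CK κ → UK κ) : Set (CK κ) :=
  {f | (∃ u, IsOrbit S f u) ∧ ∃ h₀ : ℝ≥0, 0 < h₀ ∧ ∃ c : ℝ≥0, ∀ h ≤ h₀,
    normK κ (increment S f h) ≤ (c * h : ℝ≥0)}

/-- The upper Lipschitz set of `S`. -/
def upperLipschitzSet {κ : X → ℝ} (S : ℝ≥0 → CK κ → UK κ) : Set (CK κ) :=
  {f | (∃ u, IsOrbit S f u) ∧ ∃ h₀ : ℝ≥0, 0 < h₀ ∧ ∃ c : ℝ≥0, ∀ h ≤ h₀,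
    normK κ (fun x => max (increment S f h x) 0) ≤ (c * h : ℝ≥0)}

/-- The upper `Γ`-generator of `S`, the `Γ`-limit superior of `(S(h) f - f) / h` as `h ↓ 0`
(meaningful on the upper Lipschitz set). -/
noncomputable def upperGammaGenerator {κ : X → ℝ} (S : ℝ≥0 → CK κ → UK κ) (f : CK κ) :
    X → EReal :=
  gammaLimsup (𝓝[>] 0) (fun h x => increment S f h x / ((h : ℝ) : EReal))

/-- The graph of the generator of `S`: the orbit `u` of `f` is continuous-function valued, has the
semigroup property, and `(S(h) f - f) / h → g` in the mixed topology as `h ↓ 0`. -/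
def IsGenerator {κ : X → ℝ} (S : ℝ≥0 → CK κ → UK κ) (f g : CK κ) : Prop :=
  ∃ u, IsOrbit S f u ∧ MixedTendsto (fun h : ℝ≥0 => (h : ℝ)⁻¹ • (u h - f)) (𝓝[>] 0) g

/-- The domain of the generator of `S`. -/
def generatorDomain {κ : X → ℝ} (S : ℝ≥0 → CK κ → UK κ) : Set (CK κ) :=
  {f | ∃ g, IsGenerator S f g}

end Spaces

end ConvexMonotone

open ConvexMonotone

/-! For `f` in the domain of the generator of `T` put u(b) = T(b)f and, at a fixed point x, F(r, b)
= (S(r)u(b))(x). The claim is F(t, 0) ≤ F(0, t), so F should not grow, up to o(h), when a time step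
h is moved from the second variable to the first. This compares S(r)S(h)u(b) = S(r)(u(b) + h p_h)
with S(r)u(b+h) = S(r)(u(b) + h q_h), where p_h and q_h are difference quotients of S(·)u(b) at 0
and of u at b.

The quotients are asymptotically ordered. As u(b+h) = T(b)(f + h q) with q → g, convexity puts the
directional derivative of T(b) at f towards g between the upper Γ-generator of `T` at u(b)
(`upperGammaGenerator_orbit_le`) and the pointwise lower right derivative of u
(`eventually_dirDeriv_le`). With the hypothesis on the generators, Γ-limsup p_h ≤ liminf q_h, the
right side being only pointwise.

S(r) respects this weak ordering (`IsRealOp.exists_increment_le`): a linear functional below its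
directional derivative is positive and continuous from above, hence satisfies bounded convergence
(`tendsto_zero_of_positive`), and Hahn–Banach lets it be bounded below along decreasing continuous
majorants of p_h by the limiting derivative there.

The local estimate is not uniform in b, so `le_antidiagonal` integrates it over a short window of b
before applying a Dini argument. Uniqueness is comparison in both directions on the invariant
Lipschitz sets, followed by continuity of S(t) and T(t) along mixed-convergent sequences. -/

namespace ConvexMonotone

/-! ### Weighted sup bounds for real functions. -/

section Basics

variable {X : Type*} {κ : X → ℝ}

/-- The weighted bound `|f x| κ x ≤ r` for all `x`. -/
def BddK (κ : X → ℝ) (f : X → ℝ) (r : ℝ) : Prop := ∀ x, |f x| * κ x ≤ r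

theorem normK_toE_le_iff {f : X → ℝ} {r : ℝ} (hr : 0 ≤ r) :
    normK κ (toE f) ≤ ENNReal.ofReal r ↔ BddK κ f r := by
  simp only [normK, iSup_le_iff, toE, EReal.abs_def, BddK]
  refine forall_congr' fun x => ?_
  rw [← ENNReal.ofReal_mul (abs_nonneg _), ENNReal.ofReal_le_ofReal_iff hr]

theorem BddK.mono {f : X → ℝ} {r s : ℝ} (h : BddK κ f r) (hrs : r ≤ s) : BddK κ f s :=
  fun x => (h x).trans hrs

theorem BddK.add (hκ : ∀ x, 0 < κ x) {f g : X → ℝ} {r s : ℝ} (hf : BddK κ f r)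
    (hg : BddK κ g s) : BddK κ (f + g) (r + s) := fun x => by
  have := mul_le_mul_of_nonneg_right (abs_add_le (f x) (g x)) (hκ x).le
  have h1 := hf x
  have h2 := hg x
  simp only [Pi.add_apply]
  linarith

theorem BddK.smul {f : X → ℝ} {r : ℝ} (hf : BddK κ f r) (c : ℝ) :
    BddK κ (c • f) (|c| * r) := fun x => by
  simp only [Pi.smul_apply, smul_eq_mul, abs_mul, mul_assoc]
  exact mul_le_mul_of_nonneg_left (hf x) (abs_nonneg _)

theorem BddK.sub (hκ : ∀ x, 0 < κ x) {f g : X → ℝ} {r s : ℝ} (hf : BddK κ f r)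
    (hg : BddK κ g s) : BddK κ (f - g) (r + s) := fun x => by
  have := mul_le_mul_of_nonneg_right (abs_sub (f x) (g x)) (hκ x).le
  have h1 := hf x
  have h2 := hg x
  simp only [Pi.sub_apply]
  linarith

theorem BddK.le_div (hκ : ∀ x, 0 < κ x) {f : X → ℝ} {r : ℝ} (hf : BddK κ f r) (x : X) :
    |f x| ≤ r / κ x := (le_div_iff₀ (hκ x)).2 (hf x)

theorem BddK.max (hκ : ∀ x, 0 < κ x) {f g : X → ℝ} {r : ℝ} (hf : BddK κ f r)
    (hg : BddK κ g r) : BddK κ (fun x => max (f x) (g x)) r := fun x => by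
  have := mul_le_mul_of_nonneg_right (abs_max_le_max_abs_abs (a := f x) (b := g x)) (hκ x).le
  refine this.trans ?_
  rcases le_total |f x| |g x| with h | h
  · simpa [h] using hg x
  · simpa [h] using hf x

end Basics

/-! ### Reduction to real-valued operators. -/

section Spaces

variable {X : Type*} [TopologicalSpace X] {κ : X → ℝ}

theorem mem_CK_iff {f : C(X, ℝ)} : f ∈ CK κ ↔ ∃ r, BddK κ f r := by
  change normK κ (toE f) < ⊤ ↔ _
  constructor
  · intro h
    refine ⟨(normK κ (toE f)).toReal, (normK_toE_le_iff ENNReal.toReal_nonneg).1 ?_⟩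
    rw [ENNReal.ofReal_toReal h.ne]
  · rintro ⟨r, hr⟩
    exact ((normK_toE_le_iff (le_max_right r 0)).2 (hr.mono (le_max_left _ _))).trans_lt
      ENNReal.ofReal_lt_top

theorem exists_bddK (f : CK κ) : ∃ r, 0 ≤ r ∧ BddK κ f.1 r := by
  obtain ⟨r, hr⟩ := mem_CK_iff.1 f.2
  exact ⟨max r 0, le_max_right _ _, hr.mono (le_max_left _ _)⟩

theorem CK.ext {f g : CK κ} (h : ∀ x, f.1 x = g.1 x) : f = g :=
  Subtype.ext (ContinuousMap.ext h)

theorem ckFn_injective : Function.Injective (ckFn : CK κ → X → EReal) := fun _ _ h =>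
  CK.ext fun x => EReal.coe_injective (congrFun h x)

theorem mem_ballK_iff {f : CK κ} {r : ℝ≥0} : f ∈ ballK κ r ↔ BddK κ f.1 r := by
  rw [← normK_toE_le_iff r.coe_nonneg]
  change normK κ (ckFn f) ≤ r ↔ _
  rw [ckFn, ENNReal.ofReal, Real.toNNReal_coe]

/-- Constructor for elements of `C_κ`. -/
def CK.mk (f : X → ℝ) (hf : Continuous f) (h : ∃ r, BddK κ f r) : CK κ :=
  ⟨⟨f, hf⟩, mem_CK_iff.2 h⟩

@[simp] theorem CK.mk_apply (f : X → ℝ) (hf : Continuous f) (h : ∃ r, BddK κ f r) (x : X) :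
    (CK.mk f hf h).1 x = f x := rfl

/-- A real valued convex monotone operator on `C_κ` that is continuous from above and maps to
upper semicontinuous functions. -/
structure IsRealOp (κ : X → ℝ) (P : CK κ → X → ℝ) : Prop where
  convex : ∀ (f g : CK κ) (a : ℝ), 0 ≤ a → a ≤ 1 → ∀ x,
    P (a • f + (1 - a) • g) x ≤ a * P f x + (1 - a) * P g x
  mono : ∀ f g : CK κ, (∀ x, f.1 x ≤ g.1 x) → ∀ x, P f x ≤ P g x
  cont : ∀ (F : ℕ → CK κ) (f : CK κ), (∀ x, Antitone fun n => (F n).1 x) →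
    (∀ x, Tendsto (fun n => (F n).1 x) atTop (𝓝 (f.1 x))) →
    ∀ x, Tendsto (fun n => P (F n) x) atTop (𝓝 (P f x))
  usc : ∀ f, UpperSemicontinuous (P f)

/-- The real value of `S(t) f` at `x`. -/
noncomputable def val (S : ℝ≥0 → CK κ → UK κ) (t : ℝ≥0) (f : CK κ) (x : X) : ℝ :=
  ((S t f).1 x).toReal

variable {S : ℝ≥0 → CK κ → UK κ}

theorem IsConvexMonotoneFamily.normK_lt_top (hS : IsConvexMonotoneFamily κ S) (t : ℝ≥0)
    (f : CK κ) : normK κ (S t f).1 < ⊤ := by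
  obtain ⟨r, hr, h⟩ := (exists_bddK f)
  refine lt_of_le_of_lt ?_ (hS.bounded ⟨r, hr⟩ t)
  refine le_trans ?_ (le_iSup₂ (f := fun s (_ : s ∈ Set.Icc 0 t) =>
    ⨆ f ∈ ballK κ ⟨r, hr⟩, normK κ (S s f).1) t ⟨zero_le, le_rfl⟩)
  exact le_iSup₂ (f := fun f (_ : f ∈ ballK κ ⟨r, hr⟩) => normK κ (S t f).1) f
    (mem_ballK_iff.2 h)

/-- The value -∞ is excluded by the norm bound: |-∞| = ∞ and κ(x) > 0 would make the weighted norm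
infinite. -/
theorem IsConvexMonotoneFamily.coe_val (hκ : ∀ x, 0 < κ x) (hS : IsConvexMonotoneFamily κ S)
    (t : ℝ≥0) (f : CK κ) (x : X) : ((val S t f x : ℝ) : EReal) = (S t f).1 x := by
  refine EReal.coe_toReal ((S t f).2.2.1 x) fun h => ?_
  have h1 : ((S t f).1 x).abs * ENNReal.ofReal (κ x) ≤ normK κ (S t f).1 :=
    le_iSup (fun x => ((S t f).1 x).abs * ENNReal.ofReal (κ x)) x
  rw [h, EReal.abs_bot, ENNReal.top_mul (by simpa using hκ x)] at h1
  exact absurd (hS.normK_lt_top t f) (not_lt.2 h1)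

theorem IsConvexMonotoneFamily.toE_val (hκ : ∀ x, 0 < κ x) (hS : IsConvexMonotoneFamily κ S)
    (t : ℝ≥0) (f : CK κ) : toE (val S t f) = (S t f).1 :=
  funext fun x => hS.coe_val hκ t f x

theorem IsConvexMonotoneFamily.val_eq (hκ : ∀ x, 0 < κ x) (hS : IsConvexMonotoneFamily κ S)
    {t : ℝ≥0} {f g : CK κ} (h : (S t f).1 = ckFn g) (x : X) : val S t f x = g.1 x := by
  have := hS.coe_val hκ t f x
  rw [h] at this
  exact EReal.coe_injective this

theorem IsConvexMonotoneFamily.isRealOp (hκ : ∀ x, 0 < κ x) (hS : IsConvexMonotoneFamily κ S)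
    (t : ℝ≥0) : IsRealOp κ (val S t) where
  convex f g a h0 h1 x := by
    have := hS.convex t f g a h0 h1 x
    simp only [← hS.coe_val hκ] at this
    exact_mod_cast this
  mono f g h x := by
    have := hS.monotone t f g (fun x => EReal.coe_le_coe_iff.2 (h x)) x
    simp only [← hS.coe_val hκ] at this
    exact_mod_cast this
  cont F f h1 h2 x := by
    have := (hS.continuous_above t F f ⟨fun _ _ hmn x => EReal.coe_le_coe_iff.2 (h1 x hmn),
      fun x => (continuous_coe_real_ereal.tendsto _).comp (h2 x)⟩).2 x
    simp only [← hS.coe_val hκ] at this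
    exact EReal.tendsto_coe.1 this
  usc f x y hy := by
    have h : (S t f).1 x < (y : EReal) := by
      rw [← hS.coe_val hκ]
      exact_mod_cast hy
    filter_upwards [(S t f).2.1 x y h] with z hz
    rw [← hS.coe_val hκ] at hz
    exact_mod_cast hz

theorem IsConvexMonotoneFamily.exists_bound (hκ : ∀ x, 0 < κ x)
    (hS : IsConvexMonotoneFamily κ S) (r : ℝ) (t : ℝ≥0) :
    ∃ M, 0 ≤ M ∧ ∀ s ≤ t, ∀ f : CK κ, BddK κ f.1 r → BddK κ (val S s f) M := by
  have h := hS.bounded r.toNNReal t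
  refine ⟨_, ENNReal.toReal_nonneg, fun s hs f hf =>
    (normK_toE_le_iff ENNReal.toReal_nonneg).1 (le_of_le_of_eq ?_ (ENNReal.ofReal_toReal h.ne).symm)⟩
  rw [hS.toE_val hκ]
  refine le_trans ?_ (le_iSup₂ (f := fun s (_ : s ∈ Set.Icc 0 t) =>
    ⨆ f ∈ ballK κ r.toNNReal, normK κ (S s f).1) s ⟨zero_le, hs⟩)
  exact le_iSup₂ (f := fun f (_ : f ∈ ballK κ r.toNNReal) => normK κ (S s f).1) f
    (mem_ballK_iff.2 (hf.mono (Real.le_coe_toNNReal r)))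

theorem IsConvexMonotoneFamily.val_zero (hκ : ∀ x, 0 < κ x)
    (hS : IsConvexMonotoneFamily κ S) (f : CK κ) (x : X) : val S 0 f x = f.1 x :=
  hS.val_eq hκ (hS.initial f) x

theorem normK_increment_le_iff (hκ : ∀ x, 0 < κ x) (hS : IsConvexMonotoneFamily κ S)
    (f : CK κ) (h : ℝ≥0) (c : ℝ≥0) :
    normK κ (increment S f h) ≤ c ↔ BddK κ (fun x => val S h f x - f.1 x) c := by
  have : increment S f h = toE (fun x => val S h f x - f.1 x) := by
    funext x
    simp only [increment, ← hS.coe_val hκ, toE, ckFn]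
    norm_cast
  rw [this, ← normK_toE_le_iff c.coe_nonneg, ENNReal.ofReal, Real.toNNReal_coe]

theorem val_sub_le_of_normK (hκ : ∀ x, 0 < κ x) (hS : IsConvexMonotoneFamily κ S)
    {f : CK κ} {h : ℝ≥0} {c : ℝ≥0}
    (H : normK κ (fun x => max (increment S f h x) 0) ≤ c) (x : X) :
    val S h f x - f.1 x ≤ c / κ x := by
  have : (fun x => max (increment S f h x) 0) = toE (fun x => max (val S h f x - f.1 x) 0) := by
    funext x
    simp only [increment, ← hS.coe_val hκ, toE, ckFn]
    norm_cast
  have h1 : normK κ (toE (fun x => max (val S h f x - f.1 x) 0)) ≤ ENNReal.ofReal c := by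
    rw [← this, ENNReal.ofReal, Real.toNNReal_coe]
    exact H
  have h2 := ((normK_toE_le_iff c.coe_nonneg).1 h1).le_div hκ x
  exact ((le_max_left _ _).trans (le_abs_self _)).trans h2

end Spaces

/-! ### Consequences of convergence in the mixed topology. -/

section Mixed

variable {X : Type*} [TopologicalSpace X] {κ : X → ℝ}

theorem isMixedCompatible_compactTopology : IsMixedCompatible κ (compactTopology κ) where
  addGroup := inferInstanceAs (IsTopologicalAddGroup (CK κ))
  smul := inferInstanceAs (ContinuousSMul ℝ (CK κ))
  locallyConvex := inferInstanceAs (LocallyConvexSpace ℝ (CK κ))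
  eq_on_balls _ := rfl

/-- The only way the mixed topology enters: it is finer than every compatible topology. Two
well-chosen compatible topologies suffice, and the infimum need not be shown compatible. -/
theorem MixedTendsto.of_isMixedCompatible {ι : Type*} {F : ι → CK κ} {l : Filter ι} {f : CK κ}
    (h : MixedTendsto F l f) {τ : TopologicalSpace (CK κ)} (hτ : IsMixedCompatible κ τ) :
    Tendsto F l (@nhds (CK κ) τ f) :=
  Tendsto.mono_right h (_root_.nhds_mono (sInf_le hτ))

/-- The linear map recording the values at `x k`, with weights `κ (x k) / (k + 1)`. -/
noncomputable def weightedEval (κ : X → ℝ) (hκ : ∀ x, 0 < κ x) (x : ℕ → X) :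
    CK κ →ₗ[ℝ] BoundedContinuousFunction ℕ ℝ where
  toFun g := BoundedContinuousFunction.ofNormedAddCommGroupDiscrete
    (fun k => g.1 (x k) * κ (x k) / (k + 1)) (exists_bddK g).choose fun k => by
      obtain ⟨h0, h1⟩ := (exists_bddK g).choose_spec
      rw [Real.norm_eq_abs, abs_div, abs_mul, abs_of_pos (hκ _),
        abs_of_pos (by positivity : (0 : ℝ) < k + 1)]
      exact (div_le_self (by have := (hκ (x k)).le; positivity) (by linarith [k.cast_nonneg (α := ℝ)])).trans
        (h1 _)
  map_add' f g := by
    ext k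
    change (f.1 (x k) + g.1 (x k)) * κ (x k) / (k + 1) =
      f.1 (x k) * κ (x k) / (k + 1) + g.1 (x k) * κ (x k) / (k + 1)
    ring
  map_smul' c g := by
    ext k
    change (c * g.1 (x k)) * κ (x k) / (k + 1) = c * (g.1 (x k) * κ (x k) / (k + 1))
    ring

theorem weightedEval_apply (hκ : ∀ x, 0 < κ x) (x : ℕ → X) (g : CK κ) (k : ℕ) :
    weightedEval κ hκ x g k = g.1 (x k) * κ (x k) / (k + 1) := rfl

/-- On a ball of radius r the k-th coordinates of two elements differ by at most 2r/(k + 1), so up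
to ε/2 only finitely many point evaluations matter. -/
theorem continuous_weightedEval_ball (hκ : ∀ x, 0 < κ x) (x : ℕ → X) (r : ℝ≥0) :
    @Continuous _ _ (TopologicalSpace.induced (Subtype.val : ballK κ r → CK κ)
      (compactTopology κ)) _ (fun g => weightedEval κ hκ x g.1) := by
  let _ : TopologicalSpace (ballK κ r) :=
    TopologicalSpace.induced (Subtype.val : ballK κ r → CK κ) (compactTopology κ)
  have hev : ∀ y : X, Continuous fun g : ballK κ r => g.1.1 y := fun y => by
    have h1 : Continuous fun g : ballK κ r => g.1.1 :=
      continuous_induced_dom.comp continuous_induced_dom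
    exact (ContinuousEvalConst.continuous_eval_const (F := C(X, ℝ)) y).comp h1
  refine continuous_iff_continuousAt.2 fun g => Metric.tendsto_nhds.2 fun ε hε => ?_
  obtain ⟨N, hN⟩ := exists_nat_gt (4 * r / ε)
  have hfin : ∀ᶠ g' : ballK κ r in 𝓝 g, ∀ k < N,
      |(g'.1.1 (x k) - g.1.1 (x k)) * κ (x k)| < ε / 2 := by
    refine (eventually_all_finite (Set.finite_lt_nat N)).2 ?_
    intro k _
    have hc : Continuous fun g' : ballK κ r => |(g'.1.1 (x k) - g.1.1 (x k)) * κ (x k)| :=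
      (((hev (x k)).sub continuous_const).mul continuous_const).abs
    refine hc.continuousAt.eventually_lt continuousAt_const ?_
    simpa using hε
  filter_upwards [hfin] with g' hg'
  refine lt_of_le_of_lt ((BoundedContinuousFunction.dist_le (by positivity : (0 : ℝ) ≤ ε / 2)).2
    fun k => ?_) (half_lt_self hε)
  have hk1 : (0 : ℝ) < k + 1 := by positivity
  rw [Real.dist_eq, weightedEval_apply, weightedEval_apply, ← sub_div, ← sub_mul, abs_div,
    abs_of_pos hk1]
  by_cases hk : k < N
  · exact (div_le_self (abs_nonneg _) (by linarith [k.cast_nonneg (α := ℝ)])).trans (hg' k hk).le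
  · have h1 := mem_ballK_iff.1 g.2 (x k)
    have h2 := mem_ballK_iff.1 g'.2 (x k)
    have h3 := mul_le_mul_of_nonneg_right (abs_sub (g'.1.1 (x k)) (g.1.1 (x k))) (hκ (x k)).le
    rw [abs_mul, abs_of_pos (hκ _), div_le_iff₀ hk1]
    have h4 : (N : ℝ) ≤ k := by exact_mod_cast not_lt.1 hk
    rw [div_lt_iff₀ hε] at hN
    nlinarith

theorem isMixedCompatible_weightedEval (hκ : ∀ x, 0 < κ x) (x : ℕ → X) :
    IsMixedCompatible κ (compactTopology κ ⊓
      TopologicalSpace.induced (weightedEval κ hκ x) inferInstance) where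
  addGroup := topologicalAddGroup_inf isMixedCompatible_compactTopology.addGroup
    (topologicalAddGroup_induced _)
  smul := by
    have h1 := (isMixedCompatible_compactTopology (κ := κ)).smul
    have h2 : @ContinuousSMul ℝ (CK κ) _ _ (TopologicalSpace.induced (weightedEval κ hκ x)
      inferInstance) := continuousSMul_induced _
    exact @continuousSMul_inf _ _ _ _ _ _ h1 h2
  locallyConvex := LocallyConvexSpace.inf isMixedCompatible_compactTopology.locallyConvex
    (LocallyConvexSpace.induced _)
  eq_on_balls r := by
    rw [induced_inf]
    refine inf_eq_left.2 ?_
    have := continuous_iff_le_induced.1 (continuous_weightedEval_ball hκ x r)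
    exact this.trans_eq induced_compose.symm

/-- If boundedness failed, there would be points y_k where the k-th chosen function has weighted
size above k + 1 + r. The factor 1/(k + 1) in `weightedEval` still leaves a distance above 1 to `f`,
contradicting convergence in a compatible topology. -/
theorem MixedTendsto.exists_eventually_bddK (hκ : ∀ x, 0 < κ x) {ι : Type*} {F : ι → CK κ}
    {l : Filter ι} [l.IsCountablyGenerated] {f : CK κ} (h : MixedTendsto F l f) :
    ∃ R, 0 ≤ R ∧ ∀ᶠ i in l, BddK κ (F i).1 R := by
  by_contra! H
  obtain ⟨r, hr0, hr⟩ := (exists_bddK f)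
  obtain ⟨B, hB⟩ := l.exists_antitone_basis
  have h1 : ∀ k : ℕ, ∃ i ∈ B k, ∃ y, (k + 1 + r : ℝ) < |(F i).1 y| * κ y := by
    intro k
    obtain ⟨i, hi, hi'⟩ := ((H (k + 1 + r) (by positivity)).and_eventually (hB.mem k)).exists
    simp only [BddK, not_forall, not_le] at hi
    exact ⟨i, hi', hi⟩
  choose i hi y hy using h1
  have h2 := (h.of_isMixedCompatible (isMixedCompatible_weightedEval hκ y)).comp (hB.tendsto hi)
  rw [nhds_inf, tendsto_inf] at h2
  replace h2 := h2.2
  rw [nhds_induced, tendsto_comap_iff] at h2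
  obtain ⟨k, hk⟩ := ((Metric.tendsto_nhds.1 h2) 1 one_pos).exists
  have h3 := (BoundedContinuousFunction.dist_coe_le_dist k).trans_lt hk
  have hk1 : (0 : ℝ) < k + 1 := by positivity
  simp only [Function.comp] at h3
  rw [Real.dist_eq, weightedEval_apply, weightedEval_apply, ← sub_div, ← sub_mul, abs_div,
    abs_of_pos hk1, div_lt_one hk1, abs_mul, abs_of_pos (hκ _)] at h3
  have h4 := hr (y k)
  have h5 := hy k
  have h6 := mul_le_mul_of_nonneg_right (abs_sub_abs_le_abs_sub ((F (i k)).1 (y k)) (f.1 (y k)))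
    (hκ (y k)).le
  linarith

/-- A convergent sequence of points together with its limit is compact, so uniform convergence on
compact sets gives convergence at moving points. -/
theorem MixedTendsto.tendsto_prod [FirstCountableTopology X] {ι : Type*} {F : ι → CK κ}
    {l : Filter ι} [l.IsCountablyGenerated] {f : CK κ} (h : MixedTendsto F l f) (y : X) :
    Tendsto (fun p : ι × X => (F p.1).1 p.2) (l ×ˢ 𝓝 y) (𝓝 (f.1 y)) := by
  refine tendsto_of_seq_tendsto fun p hp => ?_
  have hp1 : Tendsto (fun n => (p n).1) atTop l := tendsto_fst.comp hp
  have hp2 : Tendsto (fun n => (p n).2) atTop (𝓝 y) := tendsto_snd.comp hp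
  have h1 := (h.of_isMixedCompatible isMixedCompatible_compactTopology).comp hp1
  rw [nhds_induced, tendsto_comap_iff,
    ContinuousMap.tendsto_iff_forall_isCompact_tendstoUniformlyOn] at h1
  have h2 := h1 _ hp2.isCompact_insert_range
  have h3 : Tendsto (fun n => f.1 (p n).2) atTop (𝓝 (f.1 y)) :=
    (f.1.continuous.tendsto y).comp hp2
  refine h3.congr_dist ?_
  rw [Metric.tendsto_nhds]
  intro ε hε
  filter_upwards [Metric.tendstoUniformlyOn_iff.1 h2 ε hε] with n hn
  rw [Real.dist_0_eq_abs, abs_of_nonneg dist_nonneg]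
  exact hn _ (Or.inr ⟨n, rfl⟩)

end Mixed

end ConvexMonotone
-- Decreasing continuous majorants.
namespace ConvexMonotone

variable {X : Type*} {κ : X → ℝ}

/-- A sequence with a common weighted bound has decreasing continuous majorants that converge
to its `Γ`-limit superior. -/
theorem exists_antitone_majorant [MetricSpace X] (hκ_cont : Continuous κ) (hκ : ∀ x, 0 < κ x)
    (a : ℕ → X → ℝ) (M : ℝ) (ha : ∀ n, BddK κ (a n) M) :
    ∃ α : ℕ → CK κ, (∀ x, Antitone fun k => (α k).1 x) ∧
      (∀ k n, k ≤ n → ∀ x, a n x ≤ (α k).1 x) ∧ (∀ k, BddK κ (α k).1 M) ∧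
      ∀ y L, (∀ ε > 0, ∀ᶠ p : ℕ × X in atTop ×ˢ 𝓝 y, a p.1 p.2 ≤ L + ε) →
        ∀ ε > 0, ∀ᶠ k in atTop, (α k).1 y ≤ L + ε := by
  let b : ℕ → X → ℝ := fun n x => a n x * κ x
  have hb : ∀ n x, |b n x| ≤ M := fun n x => by
    simpa [b, abs_mul, abs_of_pos (hκ x)] using ha n x
  -- Sup-convolution of the tail from index k with the penalty k·d: it is k-Lipschitz in x and
  -- decreasing in k.
  let c : ℕ → X → ℝ := fun k x => ⨆ p : ℕ × X, (b (k + p.1) p.2 - k * dist x p.2)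
  have hbdd : ∀ k x, BddAbove (Set.range fun p : ℕ × X => b (k + p.1) p.2 - k * dist x p.2) := by
    rintro k x
    refine ⟨M, ?_⟩
    rintro _ ⟨p, rfl⟩
    have := (le_abs_self _).trans (hb (k + p.1) p.2)
    have h2 : 0 ≤ k * dist x p.2 := by positivity
    linarith
  have hle : ∀ k n, k ≤ n → ∀ x, b n x ≤ c k x := by
    intro k n hkn x
    have := le_ciSup (hbdd k x) (n - k, x)
    simpa [Nat.add_sub_cancel' hkn] using this
  have hcb : ∀ k x, |c k x| ≤ M := by
    intro k x
    have : Nonempty X := ⟨x⟩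
    refine abs_le.2 ⟨(neg_le_of_abs_le (hb k x)).trans (hle k k le_rfl x), ciSup_le fun p => ?_⟩
    have := (le_abs_self _).trans (hb (k + p.1) p.2)
    have h2 : 0 ≤ k * dist x p.2 := by positivity
    linarith
  have hcont : ∀ k, Continuous (c k) := by
    intro k
    refine (LipschitzWith.of_le_add_mul (k : ℝ≥0) fun x y => ?_).continuous
    have : Nonempty X := ⟨x⟩
    refine ciSup_le fun p => ?_
    have h1 := le_ciSup (hbdd k y) p
    have h2 := mul_le_mul_of_nonneg_left (dist_triangle_left y p.2 x) (Nat.cast_nonneg (α := ℝ) k)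
    simp only [NNReal.coe_natCast]
    simp only [c]
    linarith
  have hanti : ∀ x, Antitone fun k => c k x := by
    intro x
    refine antitone_nat_of_succ_le fun k => ?_
    have : Nonempty X := ⟨x⟩
    refine ciSup_le fun p => ?_
    have h1 := le_ciSup (hbdd k x) (p.1 + 1, p.2)
    have h2 : 0 ≤ dist x p.2 := dist_nonneg
    rw [show k + 1 + p.1 = k + (p.1 + 1) by omega]
    push_cast
    refine le_trans ?_ h1
    dsimp only
    linarith
  have hbd : ∀ k, BddK κ (fun x => c k x / κ x) M := fun k x => by
    rw [abs_div, abs_of_pos (hκ x), div_mul_cancel₀ _ (hκ x).ne']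
    exact hcb k x
  refine ⟨fun k => CK.mk (fun x => c k x / κ x) ((hcont k).div hκ_cont fun x => (hκ x).ne')
    ⟨M, hbd k⟩, fun x m n hmn => ?_, fun k n hkn x => ?_, hbd, fun y L hL ε hε => ?_⟩
  · exact div_le_div_of_nonneg_right (hanti x hmn) (hκ x).le
  · exact (le_div_iff₀ (hκ x)).2 (hle k n hkn x)
  · have : Nonempty X := ⟨y⟩
    have h1 : ∀ᶠ z in 𝓝 y, κ z * (L + ε / 2) < κ y * (L + ε) :=
      (hκ_cont.mul continuous_const).continuousAt.eventually_lt continuousAt_const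
        (mul_lt_mul_of_pos_left (by linarith) (hκ y))
    obtain ⟨u, hu, v, hv, huv⟩ := eventually_prod_iff.1 (hL (ε / 2) (half_pos hε))
    obtain ⟨N, hN⟩ := eventually_atTop.1 hu
    obtain ⟨δ, hδ, hδv⟩ := Metric.eventually_nhds_iff.1 (hv.and h1)
    obtain ⟨K, hK⟩ := exists_nat_gt ((M - κ y * (L + ε)) / δ)
    filter_upwards [eventually_ge_atTop N, eventually_ge_atTop K] with k hkN hkK
    rw [CK.mk_apply, div_le_iff₀ (hκ y), mul_comm]
    refine ciSup_le fun p => ?_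
    by_cases hp : dist p.2 y < δ
    · obtain ⟨h2, h3⟩ := hδv hp
      have h4 := huv (hN (k + p.1) (by omega)) h2
      have h5 := mul_le_mul_of_nonneg_right h4 (hκ p.2).le
      have h6 : 0 ≤ k * dist y p.2 := by positivity
      simp only [b]
      dsimp only at h5
      linarith
    · have h2 := (le_abs_self _).trans (hb (k + p.1) p.2)
      rw [not_lt, dist_comm] at hp
      have h3 : (K : ℝ) ≤ k := by exact_mod_cast hkK
      rw [div_lt_iff₀ hδ] at hK
      have h4 : (K : ℝ) * δ ≤ k * dist y p.2 := by gcongr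
      linarith

section InvWeight

variable [TopologicalSpace X]

/-- The function `1 / κ` as an element of `C_κ`. -/
noncomputable def invWeight (κ : X → ℝ) (hκ_cont : Continuous κ) (hκ : ∀ x, 0 < κ x) : CK κ :=
  CK.mk (fun x => (κ x)⁻¹) (hκ_cont.inv₀ fun x => (hκ x).ne') ⟨1, fun x => by
    rw [abs_of_pos (inv_pos.2 (hκ x)), inv_mul_cancel₀ (hκ x).ne']⟩

theorem bddK_invWeight (hκ_cont : Continuous κ) (hκ : ∀ x, 0 < κ x) :
    BddK κ (invWeight κ hκ_cont hκ).1 1 := fun x => by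
  change |(κ x)⁻¹| * κ x ≤ 1
  rw [abs_of_pos (inv_pos.2 (hκ x)), inv_mul_cancel₀ (hκ x).ne']

end InvWeight

/-! ### Continuity of convex monotone operators. -/

namespace IsRealOp

section Top

variable [TopologicalSpace X] {P : CK κ → X → ℝ}

theorem convex_add (hP : IsRealOp κ P) (f g : CK κ) {a : ℝ} (h0 : 0 ≤ a) (h1 : a ≤ 1) (x : X) :
    P (f + a • g) x ≤ (1 - a) * P f x + a * P (f + g) x := by
  have := hP.convex (f + g) f a h0 h1 x
  rw [show a • (f + g) + (1 - a) • f = f + a • g by module] at this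
  linarith

theorem two_mul_le (hP : IsRealOp κ P) (f g : CK κ) (x : X) :
    2 * P f x ≤ P g x + P ((2 : ℝ) • f - g) x := by
  have := hP.convex g ((2 : ℝ) • f - g) (1 / 2) (by norm_num) (by norm_num) x
  rw [show (1 / 2 : ℝ) • g + (1 - 1 / 2 : ℝ) • ((2 : ℝ) • f - g) = f by module] at this
  linarith

/-- A bound on a larger ball gives a Lipschitz estimate on a ball. -/
theorem lipschitz (hP : IsRealOp κ P) (hκ_cont : Continuous κ) (hκ : ∀ x, 0 < κ x) {R M : ℝ}
    (hM : ∀ f : CK κ, BddK κ f.1 (R + 1) → BddK κ (P f) M) {f g : CK κ} (hf : BddK κ f.1 R)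
    (hg : BddK κ g.1 R) {δ : ℝ} (hδ : 0 ≤ δ) (hfg : ∀ x, f.1 x - g.1 x ≤ δ / κ x) (x : X) :
    P f x - P g x ≤ 2 * M * δ / κ x := by
  have hR : ∀ {f : CK κ}, BddK κ f.1 R → |P f x| ≤ M / κ x := fun hf =>
    (hM _ (hf.mono (by linarith))).le_div hκ x
  have h1 := abs_le.1 (hR hf)
  have h2 := abs_le.1 (hR hg)
  have hM0 : 0 ≤ M / κ x := (abs_nonneg _).trans (hR hf)
  rw [show 2 * M * δ / κ x = 2 * (M / κ x) * δ by ring]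
  rcases le_or_gt 1 δ with hδ1 | hδ1
  · nlinarith
  -- Since 1/κ has weighted size at most 1, g + k stays in the ball of radius R + 1. By convexity
  -- the step δ·k costs at most the fraction δ of the step k.
  let k := invWeight κ hκ_cont hκ
  have hk : ∀ y, k.1 y = (κ y)⁻¹ := fun y => rfl
  have h3 : P f x ≤ P (g + δ • k) x := hP.mono _ _ (fun y => by
    have := hfg y
    change f.1 y ≤ g.1 y + δ * (κ y)⁻¹
    rw [div_eq_mul_inv] at this
    linarith) x
  have h4 := hP.convex_add g k hδ hδ1.le x
  have h5 := abs_le.1 ((hM (g + k) (hg.add hκ (bddK_invWeight hκ_cont hκ))).le_div hκ x)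
  nlinarith

/-- Convergence from above along bounded, continuously convergent families. -/
theorem eventually_le {X : Type*} [MetricSpace X] {κ : X → ℝ} {P : CK κ → X → ℝ}
    (hP : IsRealOp κ P) (hκ_cont : Continuous κ) (hκ : ∀ x, 0 < κ x)
    {ι : Type*} {l : Filter ι} [l.IsCountablyGenerated] {F : ι → CK κ} {f : CK κ} {R : ℝ}
    (hb : ∀ᶠ i in l, BddK κ (F i).1 R)
    (hF : ∀ y, Tendsto (fun p : ι × X => (F p.1).1 p.2) (l ×ˢ 𝓝 y) (𝓝 (f.1 y)))
    (x : X) {ε : ℝ} (hε : 0 < ε) :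
    ∀ᶠ p : ι × X in l ×ˢ 𝓝 x, P (F p.1) p.2 ≤ P f x + ε := by
  by_contra H
  obtain ⟨p, hp, hp'⟩ := exists_seq_forall_of_frequently
    ((not_eventually.1 H).and_eventually (hb.prod_inl _))
  have hp1 : Tendsto (fun n => (p n).1) atTop l := tendsto_fst.comp hp
  have hp2 : Tendsto (fun n => (p n).2) atTop (𝓝 x) := tendsto_snd.comp hp
  -- The majorants decrease to f, so continuity from above applies to them at x, and upper
  -- semicontinuity of P(α k) handles the moving point.
  obtain ⟨α, hα, hle, -, hlim⟩ := exists_antitone_majorant hκ_cont hκ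
    (fun n => (F (p n).1).1) R (fun n => (hp' n).2)
  have hG : ∀ y, Tendsto (fun q : ℕ × X => (F (p q.1).1).1 q.2) (atTop ×ˢ 𝓝 y) (𝓝 (f.1 y)) :=
    fun y => (hF y).comp ((hp1.comp tendsto_fst).prodMk tendsto_snd)
  have hα_lim : ∀ y, Tendsto (fun k => (α k).1 y) atTop (𝓝 (f.1 y)) := by
    intro y
    have hy : Tendsto (fun n => (F (p n).1).1 y) atTop (𝓝 (f.1 y)) :=
      (hG y).comp (tendsto_id.prodMk tendsto_const_nhds)
    refine tendsto_order.2 ⟨fun c hc => ?_, fun c hc => ?_⟩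
    · filter_upwards [hy.eventually_const_lt hc] with k hk
      exact hk.trans_le (hle k k le_rfl y)
    · filter_upwards [hlim y (f.1 y) (fun ε hε => ((hG y).eventually_lt_const
        (lt_add_of_pos_right _ hε)).mono fun _ h => h.le) ((c - f.1 y) / 2) (by linarith)] with k hk
      linarith
  obtain ⟨k, hk⟩ := ((hP.cont α f hα hα_lim x).eventually_lt_const
    (lt_add_of_pos_right _ hε)).exists
  obtain ⟨n, hn, hkn⟩ := ((hp2.eventually (hP.usc (α k) x _ hk)).and (eventually_ge_atTop k)).exists
  exact (hp' n).1 ((hP.mono _ _ (hle k n hkn) _).trans hn.le)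

/-- Continuity along bounded, continuously convergent families. -/
theorem tendsto {X : Type*} [MetricSpace X] {κ : X → ℝ} {P : CK κ → X → ℝ}
    (hP : IsRealOp κ P) (hκ_cont : Continuous κ) (hκ : ∀ x, 0 < κ x)
    {ι : Type*} {l : Filter ι} [l.IsCountablyGenerated] {F : ι → CK κ} {f : CK κ} {R : ℝ}
    (hb : ∀ᶠ i in l, BddK κ (F i).1 R)
    (hF : ∀ y, Tendsto (fun p : ι × X => (F p.1).1 p.2) (l ×ˢ 𝓝 y) (𝓝 (f.1 y)))
    (x : X) : Tendsto (fun i => P (F i) x) l (𝓝 (P f x)) := by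
  obtain ⟨r, -, hr⟩ := exists_bddK f
  have hdiag : Tendsto (fun i => (i, x)) l (l ×ˢ 𝓝 x) :=
    tendsto_id.prodMk tendsto_const_nhds
  refine tendsto_order.2 ⟨fun c hc => ?_, fun c hc => ?_⟩
  -- The lower bound is the upper bound for the reflected family 2f - F, through 2P(f) ≤ P(F) + P(2f
  -- - F).
  · have h1 := hdiag.eventually (hP.eventually_le hκ_cont hκ (F := fun i => (2 : ℝ) • f - F i)
      (f := f) (R := |2| * r + R) (hb.mono fun i hi => BddK.sub hκ (hr.smul 2) hi) (fun y => by
        have h2 : Tendsto (fun p : ι × X => f.1 p.2) (l ×ˢ 𝓝 y) (𝓝 (f.1 y)) :=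
          (f.1.continuous.tendsto y).comp tendsto_snd
        have := (h2.const_mul 2).sub (hF y)
        rw [show 2 * f.1 y - f.1 y = f.1 y by ring] at this
        exact this) x (half_pos (sub_pos.2 hc)))
    filter_upwards [h1] with i hi
    have := hP.two_mul_le f (F i) x
    linarith
  · filter_upwards [hdiag.eventually (hP.eventually_le hκ_cont hκ hb hF x
      (half_pos (sub_pos.2 hc)))] with i hi
    linarith

end Top

end IsRealOp

end ConvexMonotone
-- A Hahn–Banach lemma with a lower bound along a sequence.
namespace ConvexMonotone

/-- A sublinear functional dominates a linear functional with prescribed lower bound along a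
sequence on which the sublinear functional decreases. -/
theorem exists_linear_le_sublinear_of_le {E : Type*} [AddCommGroup E] [Module ℝ E] (N : E → ℝ)
    (hN_smul : ∀ c : ℝ, 0 < c → ∀ v, N (c • v) = c * N v)
    (hN_add : ∀ v w, N (v + w) ≤ N v + N w) (α : ℕ → E)
    (hα : ∀ (c : ℝ), 0 ≤ c → ∀ f j k, j ≤ k → N (f + c • α k) ≤ N (f + c • α j))
    {m : ℝ} (hm : ∀ k, m ≤ N (α k)) :
    ∃ ℓ : E →ₗ[ℝ] ℝ, (∀ v, ℓ v ≤ N v) ∧ ∀ k, m ≤ ℓ (α k) := by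
  have hN0 : N 0 = 0 := by
    have := hN_smul 2 two_pos 0
    rw [smul_zero] at this
    linarith
  have hlow : ∀ f (p : ℝ≥0 × ℕ), -N (-f) ≤ N (f + (p.1 : ℝ) • α p.2) - p.1 * m := by
    rintro f ⟨c, k⟩
    have h1 : c * m ≤ N ((c : ℝ) • α k) := by
      rcases eq_or_ne c 0 with rfl | hc
      · simp [hN0]
      · have hc' : (0 : ℝ) < c := by positivity
        rw [hN_smul c hc']
        exact mul_le_mul_of_nonneg_left (hm k) hc'.le
    have h2 := hN_add (f + (c : ℝ) • α k) (-f)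
    rw [show f + (c : ℝ) • α k + -f = (c : ℝ) • α k by abel] at h2
    dsimp only
    linarith
  -- A linear ℓ ≤ N with ℓ(α k) ≥ m for all k must lie below this functional. Conversely c = 0
  -- recovers ℓ ≤ N, and f = -α k with c = 1 recovers ℓ(α k) ≥ m.
  let N' : E → ℝ := fun f => ⨅ p : ℝ≥0 × ℕ, (N (f + (p.1 : ℝ) • α p.2) - p.1 * m)
  have hbdd : ∀ f, BddBelow (Set.range fun p : ℝ≥0 × ℕ => N (f + (p.1 : ℝ) • α p.2) - p.1 * m) :=
    fun f => ⟨-N (-f), by rintro _ ⟨p, rfl⟩; exact hlow f p⟩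
  have hle : ∀ f (c : ℝ≥0) (k : ℕ), N' f ≤ N (f + (c : ℝ) • α k) - c * m := fun f c k =>
    ciInf_le (hbdd f) (c, k)
  have hsmul_le : ∀ c : ℝ, 0 < c → ∀ v, N' (c • v) ≤ c * N' v := by
    intro c hc v
    rw [mul_comm, ← div_le_iff₀ hc]
    refine le_ciInf fun p => ?_
    rw [div_le_iff₀ hc]
    refine (hle (c • v) (c.toNNReal * p.1) p.2).trans (le_of_eq ?_)
    rw [NNReal.coe_mul, Real.coe_toNNReal c hc.le, mul_smul, ← smul_add, hN_smul c hc]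
    ring
  obtain ⟨ℓ, -, hℓ⟩ := exists_extension_of_le_sublinear (⊥ : E →ₗ.[ℝ] ℝ) N'
    (fun c hc v => le_antisymm (hsmul_le c hc v) (by
      have := hsmul_le c⁻¹ (inv_pos.2 hc) (c • v)
      rw [inv_smul_smul₀ hc.ne'] at this
      calc c * N' v ≤ c * (c⁻¹ * N' (c • v)) := mul_le_mul_of_nonneg_left this hc.le
        _ = N' (c • v) := by field_simp))
    (fun v w => by
      rw [← sub_le_iff_le_add]
      refine le_ciInf fun p => ?_
      rw [sub_le_comm]
      refine le_ciInf fun q => ?_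
      rw [sub_le_iff_le_add]
      -- Monotonicity along the sequence moves both near-minimizers to one common index, which makes
      -- N' subadditive.
      have h1 := hle (v + w) (p.1 + q.1) (max p.2 q.2)
      have h2 := hN_add (v + (p.1 : ℝ) • α (max p.2 q.2)) (w + (q.1 : ℝ) • α (max p.2 q.2))
      rw [show v + (p.1 : ℝ) • α (max p.2 q.2) + (w + (q.1 : ℝ) • α (max p.2 q.2)) =
        v + w + ((p.1 + q.1 : ℝ≥0) : ℝ) • α (max p.2 q.2) by push_cast; module] at h2
      have h3 := hα p.1 p.1.coe_nonneg v _ _ (le_max_left p.2 q.2)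
      have h4 := hα q.1 q.1.coe_nonneg w _ _ (le_max_right p.2 q.2)
      push_cast at h1 h2
      linarith)
    (fun v => by
      have hv : (v : E) = 0 := (Submodule.mem_bot ℝ).1 v.2
      rw [hv, show v = 0 from Subtype.ext hv, LinearPMap.map_zero]
      refine le_ciInf fun p => ?_
      have := hlow 0 p
      rwa [neg_zero, hN0, neg_zero] at this)
  refine ⟨ℓ, fun v => ?_, fun k => ?_⟩
  · have := (hℓ v).trans (hle v 0 0)
    simpa using this
  · have := (hℓ (-α k)).trans (hle (-α k) 1 k)
    simp only [NNReal.coe_one, one_smul, neg_add_cancel, hN0, map_neg] at this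
    linarith

/-! ### Bounded convergence for positive functionals, without measures. -/

section Lattice

variable {X : Type*} [TopologicalSpace X] {κ : X → ℝ}

/-- Pointwise maximum in `C_κ`. -/
def CK.sup (hκ : ∀ x, 0 < κ x) (f g : CK κ) : CK κ :=
  CK.mk (fun x => max (f.1 x) (g.1 x)) (by fun_prop) (by
    obtain ⟨r, _, hr⟩ := exists_bddK f
    obtain ⟨s, _, hs⟩ := exists_bddK g
    exact ⟨max r s, (hr.mono (le_max_left _ _)).max hκ (hs.mono (le_max_right _ _))⟩)

@[simp] theorem CK.sup_apply (hκ : ∀ x, 0 < κ x) (f g : CK κ) (x : X) :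
    (CK.sup hκ f g).1 x = max (f.1 x) (g.1 x) := rfl

/-- Pointwise minimum in `C_κ`. -/
def CK.inf (hκ : ∀ x, 0 < κ x) (f g : CK κ) : CK κ := f + g - CK.sup hκ f g

@[simp] theorem CK.inf_apply (hκ : ∀ x, 0 < κ x) (f g : CK κ) (x : X) :
    (CK.inf hκ f g).1 x = min (f.1 x) (g.1 x) := by
  change f.1 x + g.1 x - max (f.1 x) (g.1 x) = _
  linarith [min_add_max (f.1 x) (g.1 x)]

/-- The maximum of `z n, …, z (n + m)`. -/
def CK.blockSup (hκ : ∀ x, 0 < κ x) (z : ℕ → CK κ) (n : ℕ) : ℕ → CK κ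
  | 0 => z n
  | m + 1 => CK.sup hκ (CK.blockSup hκ z n m) (z (n + m + 1))

theorem CK.blockSup_mono (hκ : ∀ x, 0 < κ x) (z : ℕ → CK κ) (n : ℕ) (x : X) :
    Monotone fun m => (CK.blockSup hκ z n m).1 x :=
  monotone_nat_of_le_succ fun m => by simp [CK.blockSup]

theorem CK.le_blockSup (hκ : ∀ x, 0 < κ x) (z : ℕ → CK κ) (n m : ℕ) (x : X) :
    (z n).1 x ≤ (CK.blockSup hκ z n m).1 x := CK.blockSup_mono hκ z n x m.zero_le

theorem CK.blockSup_le (hκ : ∀ x, 0 < κ x) (z : ℕ → CK κ) (n : ℕ) (x : X) {c : ℝ}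
    (h : ∀ k ≥ n, (z k).1 x ≤ c) (m : ℕ) : (CK.blockSup hκ z n m).1 x ≤ c := by
  induction m with
  | zero => exact h n le_rfl
  | succ m ih => exact max_le ih (h _ (by omega))

theorem CK.blockSup_succ_left_le (hκ : ∀ x, 0 < κ x) (z : ℕ → CK κ) (n m : ℕ) (x : X) :
    (CK.blockSup hκ z (n + 1) m).1 x ≤ (CK.blockSup hκ z n (m + 1)).1 x := by
  induction m with
  | zero => simp [CK.blockSup]
  | succ m ih =>
    rw [CK.blockSup, CK.sup_apply, CK.blockSup, CK.sup_apply,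
      show n + 1 + m + 1 = n + (m + 1) + 1 by omega]
    exact max_le_max ih le_rfl

/-- The minimum of the maxima over blocks of lengths `m 0, …, m n`. -/
def CK.blockInf (hκ : ∀ x, 0 < κ x) (z : ℕ → CK κ) (m : ℕ → ℕ) : ℕ → CK κ
  | 0 => CK.blockSup hκ z 0 (m 0)
  | n + 1 => CK.inf hκ (CK.blockInf hκ z m n) (CK.blockSup hκ z (n + 1) (m (n + 1)))

theorem CK.blockInf_le (hκ : ∀ x, 0 < κ x) (z : ℕ → CK κ) (m : ℕ → ℕ) (n : ℕ) (x : X) :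
    (CK.blockInf hκ z m n).1 x ≤ (CK.blockSup hκ z n (m n)).1 x := by
  cases n <;> simp [CK.blockInf]

theorem CK.blockInf_nonneg (hκ : ∀ x, 0 < κ x) (z : ℕ → CK κ) (m : ℕ → ℕ) (x : X)
    (hz : ∀ n, 0 ≤ (z n).1 x) (n : ℕ) : 0 ≤ (CK.blockInf hκ z m n).1 x := by
  induction n with
  | zero => exact (hz 0).trans (CK.le_blockSup hκ z _ _ x)
  | succ n ih =>
    rw [CK.blockInf, CK.inf_apply]
    exact le_min ih ((hz _).trans (CK.le_blockSup hκ z _ _ x))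

/-- Bounded convergence for positive linear functionals on `C_κ` that are continuous from above. -/
theorem tendsto_zero_of_positive (hκ_cont : Continuous κ) (hκ : ∀ x, 0 < κ x)
    (ℓ : CK κ →ₗ[ℝ] ℝ) (hpos : ∀ f : CK κ, (∀ x, 0 ≤ f.1 x) → 0 ≤ ℓ f)
    (hcont : ∀ F : ℕ → CK κ, (∀ x, Antitone fun n => (F n).1 x) →
      (∀ x, Tendsto (fun n => (F n).1 x) atTop (𝓝 0)) → Tendsto (fun n => ℓ (F n)) atTop (𝓝 0))
    (z : ℕ → CK κ) (hz : ∀ n x, 0 ≤ (z n).1 x) {R : ℝ} (hzR : ∀ n, BddK κ (z n).1 R)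
    (hlim : ∀ x, Tendsto (fun n => (z n).1 x) atTop (𝓝 0)) :
    Tendsto (fun n => ℓ (z n)) atTop (𝓝 0) := by
  have hmono : ∀ f g : CK κ, (∀ x, f.1 x ≤ g.1 x) → ℓ f ≤ ℓ g := fun f g h => by
    have := hpos (g - f) fun x => sub_nonneg.2 (h x)
    rw [map_sub] at this
    linarith
  refine tendsto_order.2 ⟨fun c hc => Eventually.of_forall fun n => hc.trans_le (hpos _ (hz n)),
    fun ε hε => ?_⟩
  have hbd : ∀ n m, ℓ (CK.blockSup hκ z n m) ≤ ℓ (R • invWeight κ hκ_cont hκ) := fun n m =>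
    hmono _ _ fun x => CK.blockSup_le hκ z n x (fun k _ => by
      change (z k).1 x ≤ R * (κ x)⁻¹
      rw [← div_eq_mul_inv]
      exact (le_abs_self _).trans ((hzR k).le_div hκ x)) m
  let e : ℕ → ℝ := fun n => ε / 2 / 2 / 2 ^ n
  have he : ∀ n, 0 < e n := fun n => by positivity
  -- The supremum of a whole tail need not be continuous. A finite block that exhausts it up to e n,
  -- as seen by ℓ, replaces it.
  have hm : ∀ n, ∃ m, ∀ M, ℓ (CK.blockSup hκ z n M) ≤ ℓ (CK.blockSup hκ z n m) + e n := by
    intro n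
    have hB : BddAbove (Set.range fun m => ℓ (CK.blockSup hκ z n m)) :=
      ⟨_, by rintro _ ⟨m, rfl⟩; exact hbd n m⟩
    obtain ⟨m, hm⟩ := exists_lt_of_lt_ciSup
      (sub_lt_self (⨆ m, ℓ (CK.blockSup hκ z n m)) (he n))
    exact ⟨m, fun M => (le_ciSup hB M).trans (by linarith)⟩
  choose m hm using hm
  have key : ∀ n, ℓ (CK.blockSup hκ z n (m n)) ≤
      ℓ (CK.blockInf hκ z m n) + ∑ j ∈ Finset.range n, e j := by
    intro n
    induction n with
    | zero => simp [CK.blockInf]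
    | succ n ih =>
      let U := CK.blockInf hκ z m n
      let V := CK.blockSup hκ z (n + 1) (m (n + 1))
      have h1 : ℓ (CK.sup hκ U V) ≤ ℓ (CK.blockSup hκ z n (max (m n) (m (n + 1) + 1))) :=
        hmono _ _ fun x => max_le ((CK.blockInf_le hκ z m n x).trans
          (CK.blockSup_mono hκ z n x (le_max_left _ _)))
          ((CK.blockSup_succ_left_le hκ z n _ x).trans
            (CK.blockSup_mono hκ z n x (le_max_right _ _)))
      have h2 := hm n (max (m n) (m (n + 1) + 1))
      -- Modularity: U ∨ V is still dominated by a block starting at n, so passing to the decreasing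
      -- minima loses at most e n. These minima tend to 0, where continuity from above applies.
      have h3 : ℓ (CK.blockInf hκ z m (n + 1)) = ℓ U + ℓ V - ℓ (CK.sup hκ U V) := by
        rw [CK.blockInf, CK.inf, map_sub, map_add]
      rw [Finset.sum_range_succ, h3]
      linarith
  have hsum : ∀ n, ∑ j ∈ Finset.range n, e j ≤ ε / 2 := fun n => by
    have h1 : HasSum e (ε / 2) := hasSum_geometric_two' (ε / 2)
    exact sum_le_hasSum _ (fun j _ => (he j).le) h1
  have hinf : Tendsto (fun n => ℓ (CK.blockInf hκ z m n)) atTop (𝓝 0) := by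
    refine hcont _ (fun x => antitone_nat_of_succ_le fun n => by simp [CK.blockInf]) fun x => ?_
    refine tendsto_order.2 ⟨fun c hc => Eventually.of_forall fun n =>
      hc.trans_le (CK.blockInf_nonneg hκ z m x (fun n => hz n x) n), fun c hc => ?_⟩
    obtain ⟨N, hN⟩ := eventually_atTop.1 ((hlim x).eventually_lt_const (half_pos hc))
    filter_upwards [eventually_ge_atTop N] with n hn
    exact ((CK.blockInf_le hκ z m n x).trans (CK.blockSup_le hκ z n x
      (fun k hk => (hN k (hn.trans hk)).le) _)).trans_lt (half_lt_self hc)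
  filter_upwards [hinf.eventually_lt_const (half_pos hε)] with n hn
  have := hmono _ _ (CK.le_blockSup hκ z n (m n))
  linarith [key n, hsum n]

end Lattice

/-! ### Directional derivatives and comparison of increments. -/

section Derivative

variable {X : Type*} [TopologicalSpace X] {κ : X → ℝ} {P : CK κ → X → ℝ}

/-- The directional derivative of `f ↦ P f x` at `u`. -/
noncomputable def dirDeriv (P : CK κ → X → ℝ) (x : X) (u v : CK κ) : ℝ :=
  ⨅ h : Set.Ioi (0 : ℝ), (P (u + h.1 • v) x - P u x) / h.1

namespace IsRealOp

theorem quotient_mono (hP : IsRealOp κ P) (x : X) (u v : CK κ) {h k : ℝ} (hh : 0 < h)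
    (hk : h ≤ k) : (P (u + h • v) x - P u x) / h ≤ (P (u + k • v) x - P u x) / k := by
  have hk0 := hh.trans_le hk
  have h1 := hP.convex_add u (k • v) (a := h / k) (by positivity) ((div_le_one hk0).2 hk) x
  rw [smul_smul, div_mul_cancel₀ _ hk0.ne'] at h1
  rw [div_le_iff₀ hh]
  calc P (u + h • v) x - P u x ≤ h / k * (P (u + k • v) x - P u x) := by linarith
    _ = _ := by ring

/-- u is the convex combination of u + hv and u - v with weights 1/(1 + h) and h/(1 + h). This keeps
the infimum in `dirDeriv` finite. -/
theorem le_quotient (hP : IsRealOp κ P) (x : X) (u v : CK κ) {h : ℝ} (hh : 0 < h) :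
    P u x - P (u - v) x ≤ (P (u + h • v) x - P u x) / h := by
  have h1 := hP.convex (u + h • v) (u - v) (1 / (1 + h)) (by positivity)
    ((div_le_one (by positivity)).2 (by linarith)) x
  have hne : 1 + h ≠ 0 := by positivity
  have h3 : 1 - 1 / (1 + h) = h / (1 + h) := by field_simp; ring
  rw [h3, show (1 / (1 + h)) • (u + h • v) + (h / (1 + h)) • (u - v) = u by
    match_scalars <;> field_simp; ring] at h1
  rw [le_div_iff₀ hh]
  have h4 : (1 + h) * P u x ≤ P (u + h • v) x + h * P (u - v) x := by
    calc (1 + h) * P u x ≤ (1 + h) * (1 / (1 + h) * P (u + h • v) x + h / (1 + h) * P (u - v) x) :=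
          mul_le_mul_of_nonneg_left h1 (by positivity)
      _ = _ := by field_simp
  linarith

theorem bddBelow_quotient (hP : IsRealOp κ P) (x : X) (u v : CK κ) :
    BddBelow (Set.range fun h : Set.Ioi (0 : ℝ) => (P (u + h.1 • v) x - P u x) / h.1) :=
  ⟨P u x - P (u - v) x, by rintro _ ⟨h, rfl⟩; exact hP.le_quotient x u v h.2⟩

theorem dirDeriv_le (hP : IsRealOp κ P) (x : X) (u v : CK κ) {h : ℝ} (hh : 0 < h) :
    dirDeriv P x u v ≤ (P (u + h • v) x - P u x) / h :=
  ciInf_le (hP.bddBelow_quotient x u v) (⟨h, hh⟩ : Set.Ioi (0 : ℝ))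

theorem dirDeriv_eventually (hP : IsRealOp κ P) (x : X) (u v : CK κ) {c : ℝ}
    (hc : dirDeriv P x u v < c) :
    ∀ᶠ h in 𝓝[>] (0 : ℝ), (P (u + h • v) x - P u x) / h < c := by
  obtain ⟨⟨k, hk⟩, hkc⟩ := exists_lt_of_ciInf_lt hc
  filter_upwards [Ioc_mem_nhdsGT hk] with h hh
  exact (hP.quotient_mono x u v hh.1 hh.2).trans_lt hkc

theorem dirDeriv_mono (hP : IsRealOp κ P) (x : X) (u : CK κ) {v w : CK κ}
    (h : ∀ y, v.1 y ≤ w.1 y) : dirDeriv P x u v ≤ dirDeriv P x u w := by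
  refine le_ciInf fun k => (hP.dirDeriv_le x u v k.2).trans ?_
  have hk : (0 : ℝ) < k.1 := k.2
  gcongr
  refine hP.mono _ _ (fun y => ?_) x
  change u.1 y + k.1 * v.1 y ≤ u.1 y + k.1 * w.1 y
  have := h y
  gcongr

theorem dirDeriv_smul_le (hP : IsRealOp κ P) (x : X) (u : CK κ) {c : ℝ} (hc : 0 < c)
    (v : CK κ) : dirDeriv P x u (c • v) ≤ c * dirDeriv P x u v := by
  rw [mul_comm, ← div_le_iff₀ hc]
  refine le_ciInf fun k => ?_
  have hk : (0 : ℝ) < k.1 := k.2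
  rw [div_le_iff₀ hc]
  refine (hP.dirDeriv_le x u (c • v) (h := k.1 / c) (by positivity)).trans (le_of_eq ?_)
  rw [smul_smul, div_mul_cancel₀ _ hc.ne']
  field_simp

theorem dirDeriv_smul (hP : IsRealOp κ P) (x : X) (u : CK κ) {c : ℝ} (hc : 0 < c)
    (v : CK κ) : dirDeriv P x u (c • v) = c * dirDeriv P x u v := by
  refine le_antisymm (hP.dirDeriv_smul_le x u hc v) ?_
  have := hP.dirDeriv_smul_le x u (inv_pos.2 hc) (c • v)
  rw [inv_smul_smul₀ hc.ne'] at this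
  calc c * dirDeriv P x u v ≤ c * (c⁻¹ * dirDeriv P x u (c • v)) := by gcongr
    _ = _ := by field_simp

theorem dirDeriv_add_le (hP : IsRealOp κ P) (x : X) (u v w : CK κ) :
    dirDeriv P x u (v + w) ≤ dirDeriv P x u v + dirDeriv P x u w := by
  refine le_of_forall_pos_lt_add fun ε hε => ?_
  obtain ⟨h, ⟨h1, h2⟩, hh⟩ := (((hP.dirDeriv_eventually x u v
    (lt_add_of_pos_right _ (half_pos hε))).and (hP.dirDeriv_eventually x u w
    (lt_add_of_pos_right _ (half_pos hε)))).and self_mem_nhdsWithin).exists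
  have hh0 : 0 < h := hh
  refine (hP.dirDeriv_le x u (v + w) (half_pos hh0)).trans_lt ?_
  have h3 := hP.convex (u + h • v) (u + h • w) (1 / 2) (by norm_num) (by norm_num) x
  rw [show (1 / 2 : ℝ) • (u + h • v) + (1 - 1 / 2 : ℝ) • (u + h • w) = u + (h / 2) • (v + w) by
    module] at h3
  rw [div_lt_iff₀ hh0] at h1 h2
  rw [div_lt_iff₀ (half_pos hh0)]
  nlinarith

/-- Comparison of one-sided increments of `f ↦ P f x` in directions that are ordered
asymptotically and pointwise. -/
theorem exists_increment_le (hP : IsRealOp κ P) (hκ_cont : Continuous κ) (hκ : ∀ x, 0 < κ x)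
    (x : X) (u : CK κ) {h : ℕ → ℝ} (hh0 : ∀ n, 0 < h n) (hh : Tendsto h atTop (𝓝 0))
    {a b α : ℕ → CK κ} {R : ℝ} (hb : ∀ n, BddK κ (b n).1 R) (hαR : ∀ n, BddK κ (α n).1 R)
    (hα : ∀ y, Antitone fun n => (α n).1 y) (ha : ∀ k n, k ≤ n → ∀ y, (a n).1 y ≤ (α k).1 y)
    (hαb : ∀ y, ∀ ε > 0, ∀ᶠ n in atTop, (α n).1 y ≤ (b n).1 y + ε) {ε : ℝ} (hε : 0 < ε) :
    ∃ n, P (u + h n • a n) x ≤ P (u + h n • b n) x + ε * h n := by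
  by_contra! H
  have hh' : Tendsto h atTop (𝓝[>] 0) :=
    tendsto_nhdsWithin_iff.2 ⟨hh, Eventually.of_forall hh0⟩
  let π := dirDeriv P x u
  have hlow : ∀ v, P u x - P (u - v) x ≤ π v := fun v =>
    le_ciInf fun k => hP.le_quotient x u v k.2
  have hle : ∀ v, π v ≤ P (u + v) x - P u x := fun v => by
    have := hP.dirDeriv_le x u v one_pos
    simpa using this
  have hbdd : BddBelow (Set.range fun k => π (α k)) := by
    refine ⟨π (-(R • invWeight κ hκ_cont hκ)), ?_⟩
    rintro _ ⟨k, rfl⟩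
    refine hP.dirDeriv_mono x u fun y => ?_
    change -(R * (κ y)⁻¹) ≤ (α k).1 y
    rw [← div_eq_mul_inv]
    exact neg_le_of_abs_le ((hαR k).le_div hκ y)
  have hdir : ∀ c : ℝ, 0 ≤ c → ∀ (f : CK κ) (j k : ℕ), j ≤ k →
      π (f + c • α k) ≤ π (f + c • α j) := fun c hc f j k hjk =>
    hP.dirDeriv_mono x u fun y => by
      change f.1 y + c * (α k).1 y ≤ f.1 y + c * (α j).1 y
      have : (α k).1 y ≤ (α j).1 y := hα y hjk
      gcongr
  -- With m = inf π(α k), the increments along a n are at most h n (m + ε/2) eventually, while those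
  -- along b n are at least h n ℓ(b n) ≥ h n (m - ℓ(z n)). Bounded convergence sends ℓ(z n) to 0.
  have hex : ∃ ℓ : CK κ →ₗ[ℝ] ℝ, (∀ v, ℓ v ≤ π v) ∧ ∀ k, ⨅ k, π (α k) ≤ ℓ (α k) := by
    refine exists_linear_le_sublinear_of_le π ?_ ?_ α hdir ?_
    · exact fun c hc v => hP.dirDeriv_smul x u hc v
    · exact hP.dirDeriv_add_le x u
    · exact fun k => ciInf_le hbdd k
  obtain ⟨ℓ, hℓ, hm⟩ := hex
  have hpos : ∀ f : CK κ, (∀ x, 0 ≤ f.1 x) → 0 ≤ ℓ f := fun f hf => by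
    have h1 := (hℓ (-f)).trans (hle (-f))
    have h2 := hP.mono (u + -f) u (fun y => by
      change u.1 y + -f.1 y ≤ u.1 y
      linarith [hf y]) x
    rw [map_neg] at h1
    linarith
  have hcont : ∀ F : ℕ → CK κ, (∀ x, Antitone fun n => (F n).1 x) →
      (∀ x, Tendsto (fun n => (F n).1 x) atTop (𝓝 0)) →
      Tendsto (fun n => ℓ (F n)) atTop (𝓝 0) := fun F hF1 hF2 => by
    have h1 : Tendsto (fun n => P (u + F n) x - P u x) atTop (𝓝 (P u x - P u x)) :=
      (hP.cont (fun n => u + F n) u (fun y => (hF1 y).const_add _) (fun y => by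
        simpa using (hF2 y).const_add (u.1 y)) x).sub_const _
    rw [sub_self] at h1
    exact squeeze_zero (fun n => hpos _ fun y => (hF1 y).le_of_tendsto (hF2 y) n)
      (fun n => (hℓ _).trans (hle _)) h1
  let z : ℕ → CK κ := fun n => CK.sup hκ (α n - b n) 0
  have hz : Tendsto (fun n => ℓ (z n)) atTop (𝓝 0) := by
    refine tendsto_zero_of_positive hκ_cont hκ ℓ hpos hcont z (fun n y => le_max_right _ _)
      (R := R + R) (fun n => BddK.max hκ ((hαR n).sub hκ (hb n)) fun y => ?_) fun y => ?_
    · have := ((hαR n).sub hκ (hb n)) y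
      have h1 : 0 ≤ R + R := le_trans (by have := (hκ y).le; positivity) this
      simpa using h1
    · refine tendsto_order.2 ⟨fun c hc => Eventually.of_forall fun n =>
        hc.trans_le (le_max_right _ _), fun c hc => ?_⟩
      filter_upwards [hαb y (c / 2) (half_pos hc)] with n hn
      refine max_lt ?_ hc
      change (α n).1 y - (b n).1 y < c
      linarith
  obtain ⟨k, hk⟩ := exists_lt_of_ciInf_lt (show ⨅ k, π (α k) < (⨅ k, π (α k)) + ε / 2 by linarith)
  obtain ⟨n, ⟨hn1, hn2⟩, hkn⟩ := (((hh'.eventually (hP.dirDeriv_eventually x u (α k) hk)).and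
    (hz.eventually_lt_const (half_pos hε))).and (eventually_ge_atTop k)).exists
  have h1 := hP.mono (u + h n • a n) (u + h n • α k) (fun y => by
    change u.1 y + h n * (a n).1 y ≤ u.1 y + h n * (α k).1 y
    have := ha k n hkn y
    have := (hh0 n).le
    gcongr) x
  have h2 := H n
  have h3 := (hℓ (b n)).trans (hP.dirDeriv_le x u (b n) (hh0 n))
  have h4 : ℓ (α n) ≤ ℓ (b n) + ℓ (z n) := by
    have := hpos (b n + z n - α n) fun y => by
      change 0 ≤ (b n).1 y + max ((α n).1 y - (b n).1 y) 0 - (α n).1 y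
      linarith [le_max_left ((α n).1 y - (b n).1 y) 0]
    rw [map_sub, map_add] at this
    linarith
  have h5 := hm n
  rw [div_lt_iff₀ (hh0 n)] at hn1
  rw [le_div_iff₀ (hh0 n)] at h3
  nlinarith [hh0 n]

end IsRealOp

end Derivative

end ConvexMonotone
-- Dini-type monotonicity in one and two variables.
namespace ConvexMonotone

/-- A function without upward jumps whose upper right Dini derivative is nonpositive decreases. -/
theorem le_of_upper_dini_nonpos {g : ℝ → ℝ} {a b C h₀ : ℝ} (hab : a ≤ b) (hC : 0 ≤ C)
    (hh₀ : 0 < h₀)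
    (hup : ∀ r h, a ≤ r → 0 ≤ h → h ≤ h₀ → r + h ≤ b → g (r + h) ≤ g r + C * h)
    (hloc : ∀ r, a ≤ r → r < b → ∀ ε > 0, ∀ᶠ h in 𝓝[>] (0 : ℝ), g (r + h) ≤ g r + ε * h) :
    g b ≤ g a := by
  have key : ∀ ε > 0, g b ≤ g a + ε * (b - a) := by
    intro ε hε
    let A : Set ℝ := {r | a ≤ r ∧ r ≤ b ∧ g r ≤ g a + ε * (r - a)}
    have haA : a ∈ A := ⟨le_rfl, hab, by simp⟩
    have hA : BddAbove A := ⟨b, fun r hr => hr.2.1⟩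
    have h1 : a ≤ sSup A := le_csSup hA haA
    have h2 : sSup A ≤ b := csSup_le ⟨a, haA⟩ fun r hr => hr.2.1
    have h3 : g (sSup A) ≤ g a + ε * (sSup A - a) := by
      refine le_of_forall_pos_lt_add fun δ hδ => ?_
      -- Within this distance the allowed upward growth is below δ, so the supremum itself satisfies
      -- the inequality defining A.
      let δ' := min h₀ (δ / (C + 1))
      have hδ' : 0 < δ' := lt_min hh₀ (by positivity)
      obtain ⟨r, hr, hrδ⟩ := exists_lt_of_lt_csSup ⟨a, haA⟩ (sub_lt_self (sSup A) hδ')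
      have hrs := le_csSup hA hr
      have h4 := hup r (sSup A - r) hr.1 (by linarith)
        (le_trans (by linarith) (min_le_left _ _)) (by linarith)
      rw [add_sub_cancel] at h4
      have h5 : (sSup A - r) < δ / (C + 1) := lt_of_lt_of_le (by linarith) (min_le_right _ _)
      rw [lt_div_iff₀ (by positivity)] at h5
      have h6 := hr.2.2
      nlinarith
    rcases h2.eq_or_lt with h4 | h4
    · rwa [h4] at h3
    · obtain ⟨h, ⟨h5, h6⟩, h7⟩ := (((hloc _ h1 h4 ε hε).and self_mem_nhdsWithin).and
        (Ioo_mem_nhdsGT (sub_pos.2 h4))).exists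
      have h6' : 0 < h := h6
      have : sSup A + h ∈ A := ⟨by linarith, by linarith [h7.2], by linarith⟩
      linarith [le_csSup hA this]
  refine le_of_forall_pos_lt_add fun ε hε => ?_
  have := key (ε / (b - a + 1)) (div_pos hε (by linarith))
  refine this.trans_lt (add_lt_add_right ?_ _)
  rw [div_mul_eq_mul_div, div_lt_iff₀ (by linarith)]
  nlinarith

/-- If the upper right derivative in the first variable is at most the lower right derivative in
the second one, then `F` increases along the antidiagonal. -/
theorem le_antidiagonal {F : ℝ → ℝ → ℝ} {t C : ℝ} (ht : 0 ≤ t) (hC : 0 ≤ C)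
    (hLip : ∀ r, 0 ≤ r → r ≤ t → ∀ b b', |F r b - F r b'| ≤ C * |b - b'|)
    (hup : ∀ b, ∃ h₀ > 0, ∃ c, 0 ≤ c ∧ ∀ r h, 0 ≤ r → 0 ≤ h → h ≤ h₀ → r + h ≤ t →
      F (r + h) b ≤ F r b + c * h)
    (hloc : ∀ r, 0 ≤ r → r < t → ∀ b, 0 ≤ b → b < t + 1 → ∀ ε > 0, ∀ᶠ h in 𝓝[>] (0 : ℝ),
      F (r + h) b ≤ F r (b + h) + ε * h) :
    F t 0 ≤ F 0 t := by
  have hcont : ∀ r, 0 ≤ r → r ≤ t → Continuous (F r) := fun r h0 h1 =>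
    (LipschitzWith.of_dist_le_mul (K := ⟨C, hC⟩) fun b b' => hLip r h0 h1 b b').continuous
  -- The constant in `hup` depends on b and only rules out upward jumps. The local comparison with
  -- the Lipschitz bound in b upgrades it to a rate C independent of b, which supplies the
  -- domination needed below.
  have hstep : ∀ b, 0 ≤ b → b < t + 1 → ∀ r r', 0 ≤ r → r ≤ r' → r' ≤ t →
      F r' b ≤ F r b + C * (r' - r) := by
    intro b hb0 hb1 r r' hr hrr' hr't
    obtain ⟨h₀, hh₀, c, hc, H⟩ := hup b
    have := le_of_upper_dini_nonpos (g := fun s => F s b - C * s) (C := c) hrr' hc hh₀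
      (fun s h hs hh hh1 hs1 => by
        have := H s h (hr.trans hs) hh hh1 (hs1.trans hr't)
        nlinarith)
      (fun s hs hs1 ε hε => by
        filter_upwards [hloc s (hr.trans hs) (hs1.trans_le hr't) b hb0 hb1 ε hε,
          self_mem_nhdsWithin] with h h1 h2
        have h2' : 0 < h := h2
        have h3 := (le_abs_self _).trans (hLip s (hr.trans hs) (hs1.le.trans hr't) (b + h) b)
        rw [add_sub_cancel_left, abs_of_pos h2'] at h3
        linarith)
    linarith
  -- Along the antidiagonal the base point b = t - r - h moves with h, where `hloc` gives no
  -- uniformity. Averaging over a window of width η reduces the matter to dominated convergence in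
  -- b. The window reaches t + η, hence the margin t + 1.
  have main : ∀ η, 0 < η → η < 1 → F t 0 ≤ F 0 t + 2 * C * η := by
    intro η hη hη1
    have hθ : ∀ r h b, 0 ≤ r → 0 < h → r + h ≤ t → 0 ≤ b → b ≤ t + η →
        (F (r + h) b - F r (b + h)) / h ≤ 2 * C := by
      intro r h b hr hh hrh hb hb1
      rw [div_le_iff₀ hh]
      have h1 := hstep b hb (by linarith) r (r + h) hr (by linarith) hrh
      have h3 := (neg_le_abs _).trans (hLip r hr (by linarith) (b + h) b)
      rw [add_sub_cancel_left, abs_of_pos hh] at h3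
      linarith
    have hdiff : ∀ r h, 0 ≤ r → 0 < h → r + h ≤ t →
        (∫ b in (t - (r + h))..(t - (r + h) + η), F (r + h) b) ≤
          (∫ b in (t - r)..(t - r + η), F r b) +
          (∫ b in 0..(t + η), max ((F (r + h) b - F r (b + h)) / h) 0) * h := by
      intro r h hr hh hrh
      have hc1 := hcont (r + h) (by linarith) hrh
      have hc2 : Continuous fun b => F r (b + h) :=
        (hcont r hr (by linarith)).comp (continuous_id.add continuous_const)
      have hc3 : Continuous fun b => max ((F (r + h) b - F r (b + h)) / h) 0 :=
        ((hc1.sub hc2).div_const _).max continuous_const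
      have h1 : (∫ b in (t - r)..(t - r + η), F r b) =
          ∫ b in (t - (r + h))..(t - (r + h) + η), F r (b + h) := by
        rw [intervalIntegral.integral_comp_add_right (F r)]
        congr 1 <;> ring
      have h2 : (∫ b in (t - (r + h))..(t - (r + h) + η), F (r + h) b) -
          (∫ b in (t - (r + h))..(t - (r + h) + η), F r (b + h)) ≤
          ∫ b in (t - (r + h))..(t - (r + h) + η),
            max ((F (r + h) b - F r (b + h)) / h) 0 * h := by
        rw [← intervalIntegral.integral_sub (hc1.intervalIntegrable _ _)
          (hc2.intervalIntegrable _ _)]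
        refine intervalIntegral.integral_mono_on (by linarith)
          ((hc1.sub hc2).intervalIntegrable _ _)
          ((hc3.mul continuous_const).intervalIntegrable _ _) fun b _ => ?_
        rw [← div_le_iff₀ hh]
        exact le_max_left _ _
      rw [intervalIntegral.integral_mul_const] at h2
      have h3 : (∫ b in (t - (r + h))..(t - (r + h) + η),
          max ((F (r + h) b - F r (b + h)) / h) 0) ≤
          ∫ b in 0..(t + η), max ((F (r + h) b - F r (b + h)) / h) 0 :=
        intervalIntegral.integral_mono_interval (by linarith) (by linarith) (by linarith)
          (Eventually.of_forall fun b => le_max_right _ _) (hc3.intervalIntegrable _ _)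
      have h4 := mul_le_mul_of_nonneg_right h3 hh.le
      linarith
    have hv := le_of_upper_dini_nonpos
      (g := fun r => ∫ b in (t - r)..(t - r + η), F r b) (a := 0) (b := t)
      (C := 2 * C * (t + η)) (h₀ := 1) ht (by positivity) one_pos
      (fun r h hr hh _ hrh => by
        rcases hh.eq_or_lt with rfl | hh
        · simp
        have hc1 := hcont (r + h) (by linarith) hrh
        have hc2 : Continuous fun b => F r (b + h) :=
          (hcont r hr (by linarith)).comp (continuous_id.add continuous_const)
        have hc3 : Continuous fun b => max ((F (r + h) b - F r (b + h)) / h) 0 :=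
          ((hc1.sub hc2).div_const _).max continuous_const
        have h1 : (∫ b in 0..(t + η), max ((F (r + h) b - F r (b + h)) / h) 0) ≤
            ∫ _ in 0..(t + η), 2 * C :=
          intervalIntegral.integral_mono_on (by linarith) (hc3.intervalIntegrable _ _)
            (by simp) fun b hb => max_le (hθ r h b hr hh hrh hb.1 hb.2) (by positivity)
        rw [intervalIntegral.integral_const, sub_zero, smul_eq_mul] at h1
        refine (hdiff r h hr hh hrh).trans ?_
        have h2 := mul_le_mul_of_nonneg_right h1 hh.le
        linarith)
      (fun r hr hrt ε hε => by
        have hev : ∀ᶠ h in 𝓝[>] (0 : ℝ), 0 < h ∧ r + h ≤ t := by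
          filter_upwards [Ioo_mem_nhdsGT (sub_pos.2 hrt)] with h hh
          exact ⟨hh.1, by linarith [hh.2]⟩
        have hlim : Tendsto (fun h => ∫ b in 0..(t + η), max ((F (r + h) b - F r (b + h)) / h) 0)
            (𝓝[>] (0 : ℝ)) (𝓝 (∫ _ in 0..(t + η), (0 : ℝ))) := by
          refine intervalIntegral.tendsto_integral_filter_of_dominated_convergence
            (fun _ => 2 * C) ?_ ?_ (by simp) ?_
          · filter_upwards [hev] with h hh
            have hc1 := hcont (r + h) (by linarith) hh.2
            have hc2 : Continuous fun b => F r (b + h) :=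
              (hcont r hr (by linarith)).comp (continuous_id.add continuous_const)
            exact (((hc1.sub hc2).div_const _).max continuous_const).aestronglyMeasurable
          · filter_upwards [hev] with h hh
            refine Eventually.of_forall fun b hb => ?_
            rw [Set.uIoc_of_le (by linarith)] at hb
            rw [Real.norm_eq_abs, abs_of_nonneg (le_max_right _ _)]
            exact max_le (hθ r h b hr hh.1 hh.2 hb.1.le hb.2) (by positivity)
          · refine Eventually.of_forall fun b hb => ?_
            rw [Set.uIoc_of_le (by linarith)] at hb
            refine tendsto_order.2 ⟨fun c hc => Eventually.of_forall fun h =>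
              hc.trans_le (le_max_right _ _), fun c hc => ?_⟩
            filter_upwards [hev, hloc r hr hrt b hb.1.le (by linarith [hb.2]) (c / 2)
              (half_pos hc)] with h hh h1
            refine max_lt ?_ hc
            rw [div_lt_iff₀ hh.1]
            nlinarith [hh.1]
        rw [intervalIntegral.integral_zero] at hlim
        filter_upwards [hev, hlim.eventually_lt_const hε] with h hh h1
        refine (hdiff r h hr hh.1 hh.2).trans ?_
        have := mul_le_mul_of_nonneg_right h1.le hh.1.le
        linarith)
    rw [sub_self, zero_add, sub_zero] at hv
    have h1 : ∫ _ in 0..η, (F t 0 - C * η) ≤ ∫ b in 0..η, F t b :=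
      intervalIntegral.integral_mono_on hη.le (by simp)
        ((hcont t ht le_rfl).intervalIntegrable _ _) fun b hb => by
          have := (le_abs_self _).trans (hLip t ht le_rfl 0 b)
          rw [zero_sub, abs_neg, abs_of_nonneg hb.1] at this
          have := mul_le_mul_of_nonneg_left hb.2 hC
          linarith
    have h2 : ∫ b in t..(t + η), F 0 b ≤ ∫ _ in t..(t + η), (F 0 t + C * η) :=
      intervalIntegral.integral_mono_on (by linarith)
        ((hcont 0 le_rfl ht).intervalIntegrable _ _) (by simp) fun b hb => by
          have := (le_abs_self _).trans (hLip 0 le_rfl ht b t)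
          rw [abs_of_nonneg (by linarith [hb.1])] at this
          have : C * (b - t) ≤ C * η := mul_le_mul_of_nonneg_left (by linarith [hb.2]) hC
          linarith
    rw [intervalIntegral.integral_const, smul_eq_mul, sub_zero] at h1
    rw [intervalIntegral.integral_const, smul_eq_mul, add_sub_cancel_left] at h2
    have h3 : η * (F t 0 - C * η) ≤ η * (F 0 t + C * η) := by linarith
    have h4 := le_of_mul_le_mul_left h3 hη
    linarith
  have hlim : Tendsto (fun η => F 0 t + 2 * C * η) (𝓝[>] (0 : ℝ)) (𝓝 (F 0 t + 2 * C * 0)) :=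
    ((continuous_const.add (continuous_const.mul continuous_id)).tendsto 0).mono_left
      nhdsWithin_le_nhds
  rw [mul_zero, add_zero] at hlim
  refine ge_of_tendsto hlim ?_
  filter_upwards [Ioo_mem_nhdsGT (one_pos (α := ℝ))] with η hη
  exact main η hη.1 hη.2

end ConvexMonotone
-- Orbits and their Lipschitz continuity.
namespace ConvexMonotone

section Orbit

variable {X : Type*} [TopologicalSpace X] {κ : X → ℝ} {S : ℝ≥0 → CK κ → UK κ} {f : CK κ}
  {u : ℝ≥0 → CK κ}

theorem IsOrbit.shift (hu : IsOrbit S f u) (b : ℝ≥0) :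
    IsOrbit S (u b) fun h => u (h + b) := by
  refine ⟨fun t => ?_, fun s t => ?_⟩
  · rw [← hu.2, hu.1]
  · rw [← hu.2, add_assoc, hu.2]

theorem IsOrbit.unique {v : ℝ≥0 → CK κ} (hu : IsOrbit S f u) (hv : IsOrbit S f v) : u = v :=
  funext fun t => ckFn_injective ((hu.1 t).symm.trans (hv.1 t))

theorem IsOrbit.val_eq (hκ : ∀ x, 0 < κ x) (hS : IsConvexMonotoneFamily κ S)
    (hu : IsOrbit S f u) (t : ℝ≥0) (x : X) : val S t f x = (u t).1 x :=
  hS.val_eq hκ (hu.1 t) x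

theorem IsOrbit.val_orbit (hκ : ∀ x, 0 < κ x) (hS : IsConvexMonotoneFamily κ S)
    (hu : IsOrbit S f u) (s t : ℝ≥0) (x : X) : val S s (u t) x = (u (s + t)).1 x := by
  rw [← hu.val_eq hκ hS, val, val, hu.2]

theorem IsOrbit.apply_zero (hκ : ∀ x, 0 < κ x) (hS : IsConvexMonotoneFamily κ S)
    (hu : IsOrbit S f u) : u 0 = f :=
  CK.ext fun x => by rw [← hu.val_eq hκ hS, hS.val_zero hκ]

theorem IsConvexMonotoneFamily.exists_lipschitz (hκ_cont : Continuous κ) (hκ : ∀ x, 0 < κ x)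
    (hS : IsConvexMonotoneFamily κ S) (R : ℝ) (t : ℝ≥0) :
    ∃ K, 0 ≤ K ∧ ∀ s ≤ t, ∀ f g : CK κ, BddK κ f.1 R → BddK κ g.1 R → ∀ δ, 0 ≤ δ →
      (∀ x, f.1 x - g.1 x ≤ δ / κ x) → ∀ x, val S s f x - val S s g x ≤ K * δ / κ x := by
  obtain ⟨M, hM0, hM⟩ := hS.exists_bound hκ (R + 1) t
  exact ⟨2 * M, by positivity, fun s hs f g hf hg δ hδ hfg x =>
    (hS.isRealOp hκ s).lipschitz hκ_cont hκ (hM s hs) hf hg hδ hfg x⟩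

theorem IsOrbit.exists_bddK (hκ : ∀ x, 0 < κ x) (hS : IsConvexMonotoneFamily κ S)
    (hu : IsOrbit S f u) (t : ℝ≥0) : ∃ R, 0 ≤ R ∧ ∀ b ≤ t, BddK κ (u b).1 R := by
  obtain ⟨r, _, hr⟩ := ConvexMonotone.exists_bddK f
  obtain ⟨R, hR0, hR⟩ := hS.exists_bound hκ r t
  refine ⟨R, hR0, fun b hb x => ?_⟩
  rw [← hu.val_eq hκ hS]
  exact hR b hb f hr x

theorem IsOrbit.exists_lipschitz (hκ_cont : Continuous κ) (hκ : ∀ x, 0 < κ x)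
    (hS : IsConvexMonotoneFamily κ S) (hu : IsOrbit S f u) (hf : f ∈ lipschitzSet S) (t : ℝ≥0) :
    ∃ C, 0 ≤ C ∧ ∀ b b', b ≤ t → b' ≤ t → ∀ x,
      |(u b).1 x - (u b').1 x| ≤ C * |(b : ℝ) - b'| / κ x := by
  obtain ⟨-, h₀, hh₀, c, hc⟩ := hf
  obtain ⟨R, hR0, hR⟩ := hu.exists_bddK hκ hS t
  obtain ⟨K, hK0, hK⟩ := hS.exists_lipschitz hκ_cont hκ R t
  have hu0 := hu.apply_zero hκ hS
  have hh₀' : (0 : ℝ) < h₀ := hh₀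
  -- Steps up to h₀ use the Lipschitz estimate of S(b) applied to u(h) and f. Longer steps use the
  -- bound 2R on the orbit.
  have key : ∀ b h : ℝ≥0, b + h ≤ t → ∀ x,
      |(u (b + h)).1 x - (u b).1 x| ≤ (K * c + 2 * R / h₀) * h / κ x := by
    intro b h hbh x
    have hb : b ≤ t := le_self_add.trans hbh
    have hh : h ≤ t := le_add_self.trans hbh
    have hx := hκ x
    rcases le_total h h₀ with h1 | h1
    · have h2 := (normK_increment_le_iff hκ hS f h (c * h)).1 (hc h h1)
      have h3 : ∀ y, |(u h).1 y - f.1 y| ≤ (c * h : ℝ) / κ y := fun y => by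
        have := h2.le_div hκ y
        rw [hu.val_eq hκ hS] at this
        exact_mod_cast this
      have hfR : BddK κ f.1 R := hu0 ▸ hR 0 zero_le
      have h4 := hK b hb (u h) f (hR h hh) hfR (c * h) (by positivity)
        (fun y => (le_abs_self _).trans (h3 y)) x
      have h5 := hK b hb f (u h) hfR (hR h hh) (c * h) (by positivity)
        (fun y => by rw [← neg_sub]; exact (neg_le_abs _).trans (h3 y)) x
      rw [hu.val_orbit hκ hS, hu.val_eq hκ hS] at h4 h5
      refine (abs_le.2 ⟨by linarith, h4⟩).trans (div_le_div_of_nonneg_right ?_ hx.le)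
      have : 0 ≤ 2 * R / h₀ * h := by positivity
      linarith
    · have h2 := ((hR (b + h) hbh).sub hκ (hR b hb)).le_div hκ x
      refine h2.trans (div_le_div_of_nonneg_right ?_ hx.le)
      have h3 : R + R ≤ 2 * R / h₀ * h := by
        rw [div_mul_eq_mul_div, le_div_iff₀ hh₀']
        have h1' : (h₀ : ℝ) ≤ h := h1
        nlinarith
      have : 0 ≤ K * c * h := by positivity
      linarith
  refine ⟨K * c + 2 * R / h₀, by positivity, fun b b' hb hb' x => ?_⟩
  rcases le_total b b' with h | h
  · obtain ⟨k, rfl⟩ := exists_add_of_le h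
    have := key b k hb' x
    rw [abs_sub_comm]
    refine this.trans (le_of_eq ?_)
    push_cast
    rw [sub_add_cancel_left, abs_neg, abs_of_nonneg k.coe_nonneg]
  · obtain ⟨k, rfl⟩ := exists_add_of_le h
    refine (key b' k hb x).trans (le_of_eq ?_)
    push_cast
    rw [add_sub_cancel_left, abs_of_nonneg k.coe_nonneg]

theorem increment_div (hκ : ∀ x, 0 < κ x) (hS : IsConvexMonotoneFamily κ S) (f : CK κ)
    (h : ℝ≥0) (x : X) : increment S f h x / ((h : ℝ) : EReal) =
      (((val S h f x - f.1 x) / h : ℝ) : EReal) := by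
  rw [EReal.coe_div, EReal.coe_sub, hS.coe_val hκ]
  rfl

/-- Counterexamples to the joint bound would form a sequence of times tending to 0 and points
tending to y, which the Γ-limit superior takes into account. -/
theorem eventually_le_of_upperGammaGenerator_le [FirstCountableTopology X] (hκ : ∀ x, 0 < κ x)
    (hS : IsConvexMonotoneFamily κ S) {y : X} {L : ℝ}
    (hL : upperGammaGenerator S f y ≤ (L : EReal)) {s : ℕ → ℝ≥0} (hs : Tendsto s atTop (𝓝[>] 0))
    {ε : ℝ} (hε : 0 < ε) :
    ∀ᶠ p : ℕ × X in atTop ×ˢ 𝓝 y, (val S (s p.1) f p.2 - f.1 p.2) / s p.1 ≤ L + ε := by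
  by_contra H
  obtain ⟨p, hp, hp'⟩ := exists_seq_forall_of_frequently (not_eventually.1 H)
  have h1 : limsup (fun n => increment S f (s (p n).1) (p n).2 /
      (((s (p n).1 : ℝ≥0) : ℝ) : EReal)) atTop ≤ (L : EReal) := by
    refine le_trans (le_trans (b := gammaLimsupSeq (fun n x => increment S f (s (p n).1) x /
        (((s (p n).1 : ℝ≥0) : ℝ) : EReal)) y) (le_sSup ?_) (le_sSup ?_)) hL
    · exact ⟨fun n => (p n).2, tendsto_snd.comp hp, rfl⟩
    · exact ⟨fun n => s (p n).1, hs.comp (tendsto_fst.comp hp), rfl⟩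
  have h2 : ((L + ε : ℝ) : EReal) ≤ limsup (fun n => increment S f (s (p n).1) (p n).2 /
      (((s (p n).1 : ℝ≥0) : ℝ) : EReal)) atTop := by
    refine le_limsup_of_frequently_le (Frequently.of_forall fun n => ?_)
    rw [increment_div hκ hS]
    exact EReal.coe_le_coe_iff.2 (not_le.1 (hp' n)).le
  have h3 := EReal.coe_le_coe_iff.1 (h2.trans h1)
  linarith

end Orbit

/-! ### Derivatives along orbits starting in the generator domain. -/

section Generator

variable {X : Type*} [MetricSpace X] {κ : X → ℝ} {T : ℝ≥0 → CK κ → UK κ} {f g : CK κ}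
  {u : ℝ≥0 → CK κ}

/-- The difference quotient of an orbit at time zero. -/
noncomputable def orbitQuotient (f : CK κ) (u : ℝ≥0 → CK κ) (h : ℝ≥0) : CK κ :=
  (h : ℝ)⁻¹ • (u h - f)

theorem add_smul_orbitQuotient {h : ℝ≥0} (hh : 0 < h) :
    f + (h : ℝ) • orbitQuotient f u h = u h := by
  have : (h : ℝ) ≠ 0 := by positivity
  rw [orbitQuotient, smul_inv_smul₀ this]
  abel

theorem tendsto_coe_nhdsGT_zero :
    Tendsto (fun h : ℝ≥0 => (h : ℝ)) (𝓝[>] 0) (𝓝 0) :=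
  (NNReal.continuous_coe.tendsto 0).mono_left nhdsWithin_le_nhds

theorem eventually_nhdsGT_zero_pos_le {c : ℝ≥0} (hc : 0 < c) :
    ∀ᶠ h in 𝓝[>] (0 : ℝ≥0), 0 < h ∧ h ≤ c := by
  filter_upwards [Ioc_mem_nhdsGT hc] with h hh
  exact hh

/-- The upper `Γ`-generator along the orbit of a point in the domain is bounded by the
directional derivative of the semigroup. -/
theorem upperGammaGenerator_orbit_le (hκ_cont : Continuous κ) (hκ : ∀ x, 0 < κ x)
    (hT : IsConvexMonotoneFamily κ T) (hu : IsOrbit T f u)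
    (hg : MixedTendsto (orbitQuotient f u) (𝓝[>] 0) g) (b : ℝ≥0) (y : X) :
    upperGammaGenerator T (u b) y ≤ (dirDeriv (val T b) y f g : EReal) := by
  have hP := hT.isRealOp hκ b
  obtain ⟨R, hR0, hR⟩ := hg.exists_eventually_bddK hκ
  obtain ⟨r, -, hr⟩ := exists_bddK f
  refine sSup_le ?_
  rintro _ ⟨s, hs, rfl⟩
  refine sSup_le ?_
  rintro _ ⟨z, hz, rfl⟩
  by_contra! H
  obtain ⟨c, hc1, hc2⟩ := EReal.lt_iff_exists_real_btwn.1 H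
  refine hc2.not_ge (limsup_le_of_le (h := ?_))
  -- A fixed step k almost attains the directional derivative. Convexity bounds all quotients with
  -- smaller step by the one at k, where the direction can pass to its limit g even at moving
  -- points.
  obtain ⟨⟨k, hk⟩, hkc⟩ := exists_lt_of_ciInf_lt (EReal.coe_lt_coe_iff.1 hc1)
  have hk0 : 0 < k := hk
  dsimp only at hkc
  rw [div_lt_iff₀ hk0] at hkc
  let ε := (c * k - (val T b (f + k • g) y - val T b f y)) / 2
  have hε : 0 < ε := by simp only [ε]; linarith
  have h1 := hP.eventually_le hκ_cont hκ (l := 𝓝[>] (0 : ℝ≥0))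
    (F := fun h => f + k • orbitQuotient f u h) (f := f + k • g) (R := r + |k| * R)
    (hR.mono fun h hh => hr.add hκ (hh.smul k)) (fun x => by
      have h2 : Tendsto (fun p : ℝ≥0 × X => f.1 p.2) (𝓝[>] 0 ×ˢ 𝓝 x) (𝓝 (f.1 x)) :=
        (f.1.continuous.tendsto x).comp tendsto_snd
      exact h2.add ((hg.tendsto_prod x).const_mul k)) y hε
  have h2 := (hs.prodMk hz).eventually h1
  have h3 : Tendsto (fun n => val T b f (z n)) atTop (𝓝 (val T b f y)) := by
    simp only [hu.val_eq hκ hT]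
    exact ((u b).1.continuous.tendsto y).comp hz
  filter_upwards [h2, h3.eventually_const_lt (sub_lt_self _ hε),
    hs.eventually (eventually_nhdsGT_zero_pos_le (c := k.toNNReal) (by simpa using hk0))]
    with n h4 h5 h6
  rw [increment_div hκ hT, EReal.coe_le_coe_iff]
  have hsn : (0 : ℝ) < s n := h6.1
  have hsk : (s n : ℝ) ≤ k := (Real.le_toNNReal_iff_coe_le hk0.le).1 h6.2
  have h7 := hP.quotient_mono (z n) f (orbitQuotient f u (s n)) hsn hsk
  rw [add_smul_orbitQuotient h6.1, hu.val_orbit hκ hT, hu.val_eq hκ hT b] at h7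
  rw [hu.val_eq hκ hT b (z n)] at h5
  rw [hu.val_orbit hκ hT, add_comm (s n) b]
  refine h7.trans ?_
  rw [div_le_iff₀ hk0]
  simp only [ε] at h4 h5
  linarith

/-- The lower right derivative of the orbit of a point in the domain is at least the directional
derivative of the semigroup. -/
theorem eventually_dirDeriv_le (hκ_cont : Continuous κ) (hκ : ∀ x, 0 < κ x)
    (hT : IsConvexMonotoneFamily κ T) (hu : IsOrbit T f u)
    (hg : MixedTendsto (orbitQuotient f u) (𝓝[>] 0) g) (b : ℝ≥0) (y : X) {ε : ℝ} (hε : 0 < ε) :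
    ∀ᶠ h in 𝓝[>] (0 : ℝ≥0),
      dirDeriv (val T b) y f g ≤ ((u (b + h)).1 y - (u b).1 y) / h + ε := by
  have hP := hT.isRealOp hκ b
  obtain ⟨R, hR0, hR⟩ := hg.exists_eventually_bddK hκ
  obtain ⟨r, -, hr⟩ := exists_bddK f
  obtain ⟨r', -, hr'⟩ := exists_bddK g
  have hF : ∀ x, Tendsto (fun p : ℝ≥0 × X => (f + (p.1 : ℝ) • orbitQuotient f u p.1).1 p.2)
      (𝓝[>] 0 ×ˢ 𝓝 x) (𝓝 (f.1 x)) := fun x => by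
    have h2 : Tendsto (fun p : ℝ≥0 × X => f.1 p.2) (𝓝[>] 0 ×ˢ 𝓝 x) (𝓝 (f.1 x)) :=
      (f.1.continuous.tendsto x).comp tendsto_snd
    have h3 := h2.add ((tendsto_coe_nhdsGT_zero.comp tendsto_fst).mul (hg.tendsto_prod x))
    rw [zero_mul, add_zero] at h3
    exact h3
  have hFb : ∀ᶠ h : ℝ≥0 in 𝓝[>] 0, BddK κ (f + (h : ℝ) • orbitQuotient f u h).1 (r + R) := by
    filter_upwards [hR, eventually_nhdsGT_zero_pos_le one_pos] with h h1 h2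
    refine (hr.add hκ (h1.smul (h : ℝ))).mono ?_
    rw [abs_of_nonneg h.coe_nonneg]
    have : (h : ℝ) ≤ 1 := h2.2
    nlinarith
  have h1 := hP.tendsto hκ_cont hκ hFb hF y
  -- Replacing the quotient q by g in f + h q changes T(b) by at most h times T(b)(f + h q + (g -
  -- q)) - T(b)(f + h q), by convexity. Both terms tend to T(b)f, so the change is o(h).
  have h2 := hP.tendsto hκ_cont hκ
    (F := fun h : ℝ≥0 => f + (h : ℝ) • orbitQuotient f u h + (g - orbitQuotient f u h)) (f := f)
    (l := 𝓝[>] (0 : ℝ≥0)) (R := r + R + (r' + R))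
    (by
      filter_upwards [hFb, hR] with h h1 h2
      exact h1.add hκ (hr'.sub hκ h2))
    (fun x => by
      have h2 : Tendsto (fun p : ℝ≥0 × X => g.1 p.2) (𝓝[>] 0 ×ˢ 𝓝 x) (𝓝 (g.1 x)) :=
        (g.1.continuous.tendsto x).comp tendsto_snd
      have h3 := (hF x).add (h2.sub (hg.tendsto_prod x))
      rw [sub_self, add_zero] at h3
      exact h3) y
  have h3 := h2.sub h1
  rw [sub_self] at h3
  filter_upwards [h3.eventually_lt_const hε, eventually_nhdsGT_zero_pos_le one_pos] with h h4 h5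
  have hh0 : (0 : ℝ) < h := h5.1
  have hh1 : (h : ℝ) ≤ 1 := h5.2
  have h6 := hP.convex_add (f + (h : ℝ) • orbitQuotient f u h) (g - orbitQuotient f u h)
    hh0.le hh1 y
  rw [show f + (h : ℝ) • orbitQuotient f u h + (h : ℝ) • (g - orbitQuotient f u h) =
    f + (h : ℝ) • g by module] at h6
  have h7 := hP.dirDeriv_le y f g hh0
  rw [le_div_iff₀ hh0] at h7
  rw [add_smul_orbitQuotient h5.1, hu.val_orbit hκ hT] at h4 h6
  rw [hu.val_eq hκ hT] at h7
  rw [← sub_le_iff_le_add, le_div_iff₀ hh0]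
  nlinarith

theorem IsGenerator.mem_lipschitzSet (hκ : ∀ x, 0 < κ x) (hT : IsConvexMonotoneFamily κ T)
    (h : IsGenerator T f g) : f ∈ lipschitzSet T := by
  obtain ⟨u, hu, hg⟩ := h
  refine ⟨⟨u, hu⟩, ?_⟩
  obtain ⟨R, hR0, hR⟩ := MixedTendsto.exists_eventually_bddK hκ hg
  obtain ⟨h₀, hh₀, H⟩ := mem_nhdsGT_iff_exists_Ioc_subset.1 hR
  refine ⟨h₀, hh₀, R.toNNReal, fun h hh => (normK_increment_le_iff hκ hT f h _).2 fun x => ?_⟩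
  change |val T h f x - f.1 x| * κ x ≤ _
  rw [hu.val_eq hκ hT]
  rcases (zero_le (a := h)).eq_or_lt with rfl | hpos
  · simp [hu.apply_zero hκ hT]
  · have h1 : |(h : ℝ)⁻¹ * ((u h).1 x - f.1 x)| * κ x ≤ R := H ⟨hpos, hh⟩ x
    have h2 : (0 : ℝ) < h := hpos
    rw [abs_mul, abs_of_pos (inv_pos.2 h2), mul_assoc, inv_mul_le_iff₀ h2] at h1
    rw [NNReal.coe_mul, Real.coe_toNNReal R hR0]
    linarith

theorem IsOrbit.mem_lipschitzSet (hκ_cont : Continuous κ) (hκ : ∀ x, 0 < κ x)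
    (hT : IsConvexMonotoneFamily κ T) (hu : IsOrbit T f u) (hf : f ∈ lipschitzSet T) (b : ℝ≥0) :
    u b ∈ lipschitzSet T := by
  obtain ⟨C, hC0, hC⟩ := hu.exists_lipschitz hκ_cont hκ hT hf (1 + b)
  refine ⟨⟨_, hu.shift b⟩, 1, one_pos, C.toNNReal, fun h hh =>
    (normK_increment_le_iff hκ hT _ h _).2 fun x => ?_⟩
  change |val T h (u b) x - (u b).1 x| * κ x ≤ _
  rw [hu.val_orbit hκ hT]
  have h1 := hC (h + b) b (by gcongr) le_add_self x
  rw [le_div_iff₀ (hκ x), NNReal.coe_add, add_sub_cancel_right, abs_of_nonneg h.coe_nonneg] at h1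
  rw [NNReal.coe_mul, Real.coe_toNNReal C hC0]
  exact h1

end Generator

/-! ### The local comparison, and the two conclusions. -/

section Comparison

variable {X : Type*} [MetricSpace X] {κ : X → ℝ} {S T : ℝ≥0 → CK κ → UK κ} {f g : CK κ}
  {u : ℝ≥0 → CK κ}

theorem eventually_increment_le (hκ_cont : Continuous κ) (hκ : ∀ x, 0 < κ x)
    (hS : IsConvexMonotoneFamily κ S) (hT : IsConvexMonotoneFamily κ T) (hu : IsOrbit T f u)
    (hg : MixedTendsto (orbitQuotient f u) (𝓝[>] 0) g) (hf : f ∈ lipschitzSet T) (b : ℝ≥0)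
    (hub : u b ∈ upperLipschitzSet S)
    (hgen : upperGammaGenerator S (u b) ≤ upperGammaGenerator T (u b))
    (r : ℝ≥0) (x : X) {ε : ℝ} (hε : 0 < ε) :
    ∀ᶠ h in 𝓝[>] (0 : ℝ≥0), val S (r + h) (u b) x ≤ val S r (u (b + h)) x + ε * h := by
  obtain ⟨⟨v, hv⟩, h₀, hh₀, c, hc⟩ := hub
  obtain ⟨C, hC0, hC⟩ := hu.exists_lipschitz hκ_cont hκ hT hf (b + 1)
  by_contra H
  obtain ⟨s, hs, hs'⟩ := exists_seq_forall_of_frequently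
    ((not_eventually.1 H).and_eventually ((eventually_nhdsGT_zero_pos_le hh₀).and
      (eventually_nhdsGT_zero_pos_le one_pos)))
  have hs0 : ∀ n, (0 : ℝ) < s n := fun n => (hs' n).2.1.1
  let q : ℕ → CK κ := fun n => (s n : ℝ)⁻¹ • (u (b + s n) - u b)
  let p : ℕ → CK κ := fun n => (s n : ℝ)⁻¹ • (v (s n) - u b)
  have hq : ∀ n, BddK κ (q n).1 C := fun n y => by
    have h1 := hC (b + s n) b (by have := (hs' n).2.2.2; gcongr) le_self_add y
    rw [le_div_iff₀ (hκ y), NNReal.coe_add, add_sub_cancel_left, abs_of_pos (hs0 n)] at h1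
    change |(s n : ℝ)⁻¹ * ((u (b + s n)).1 y - (u b).1 y)| * κ y ≤ C
    rw [abs_mul, abs_of_pos (inv_pos.2 (hs0 n)), mul_assoc, inv_mul_le_iff₀ (hs0 n)]
    linarith
  have hp_apply : ∀ n y, (p n).1 y = (val S (s n) (u b) y - (u b).1 y) / s n := fun n y => by
    rw [hv.val_eq hκ hS, div_eq_inv_mul]
    rfl
  have hp : ∀ n y, (p n).1 y ≤ c / κ y := fun n y => by
    have h1 := val_sub_le_of_normK hκ hS (hc (s n) (hs' n).2.1.2) y
    rw [hp_apply, div_le_iff₀ (hs0 n)]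
    refine h1.trans (le_of_eq ?_)
    push_cast
    ring
  let M := max (c : ℝ) C
  -- The upper Lipschitz set bounds p only from above. Truncating at -C/κ is harmless because q is
  -- bounded below by the same function.
  have hM : ∀ n, BddK κ (fun y => max ((p n).1 y) (-(C / κ y))) M := fun n y => by
    have hy := hκ y
    rw [← le_div_iff₀ hy, abs_le]
    have h1 : c / κ y ≤ M / κ y := by gcongr; exact le_max_left _ _
    have h2 : C / κ y ≤ M / κ y := by gcongr; exact le_max_right _ _
    have h3 : 0 ≤ C / κ y := by positivity
    exact ⟨le_max_of_le_right (by linarith), max_le ((hp n y).trans h1) (by linarith)⟩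
  obtain ⟨α, hα, hle, hαM, hlim⟩ := exists_antitone_majorant hκ_cont hκ _ M hM
  obtain ⟨n, hn⟩ := (hS.isRealOp hκ r).exists_increment_le hκ_cont hκ x (u b) (h := fun n => s n)
    hs0 (tendsto_coe_nhdsGT_zero.comp hs) (a := p) (b := q) (α := α) (R := M)
    (fun n => (hq n).mono (le_max_right _ _)) hαM hα
    (fun k n hkn y => (le_max_left _ _).trans (hle k n hkn y))
    (fun y δ hδ => by
      let β := dirDeriv (val T b) y f g
      have hβ : upperGammaGenerator S (u b) y ≤ (β : EReal) :=
        (hgen y).trans (upperGammaGenerator_orbit_le hκ_cont hκ hT hu hg b y)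
      have h1 : ∀ ε > 0, ∀ᶠ i : ℕ × X in atTop ×ˢ 𝓝 y,
          max ((p i.1).1 i.2) (-(C / κ i.2)) ≤ max β (-(C / κ y)) + ε := by
        intro ε hε
        have h2 : Tendsto (fun z => -(C / κ z)) (𝓝 y) (𝓝 (-(C / κ y))) :=
          ((continuous_const.div hκ_cont fun z => (hκ z).ne').neg).tendsto y
        filter_upwards [eventually_le_of_upperGammaGenerator_le hκ hS hβ hs hε,
          (h2.eventually_lt_const (lt_add_of_pos_right _ hε)).prod_inr atTop] with i h3 h4
        rw [hp_apply]
        exact max_le (h3.trans (by gcongr; exact le_max_left _ _))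
          (h4.le.trans (by gcongr; exact le_max_right _ _))
      filter_upwards [hlim y _ h1 (δ / 2) (half_pos hδ), hs.eventually
        (eventually_dirDeriv_le hκ_cont hκ hT hu hg b y (half_pos hδ))] with n h2 h3
      have h4 : max β (-(C / κ y)) ≤ (q n).1 y + δ / 2 := by
        refine max_le ?_ ?_
        · rw [div_eq_inv_mul] at h3
          exact h3
        · have := neg_le_of_abs_le ((hq n).le_div hκ y)
          linarith
      linarith) hε
  refine (hs' n).1 ?_
  have h1 : u b + (s n : ℝ) • p n = v (s n) := by
    simp only [p, smul_inv_smul₀ (hs0 n).ne']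
    abel
  have h2 : u b + (s n : ℝ) • q n = u (b + s n) := by
    simp only [q, smul_inv_smul₀ (hs0 n).ne']
    abel
  rw [h1, h2, hv.val_orbit hκ hS] at hn
  rwa [hv.val_eq hκ hS]

theorem val_le_val_of_generator (hκ_cont : Continuous κ) (hκ : ∀ x, 0 < κ x)
    (hS : IsConvexMonotoneFamily κ S) (hT : IsConvexMonotoneFamily κ T)
    (hg : IsGenerator T f g) (hu : IsOrbit T f u)
    (hub : ∀ b, u b ∈ upperLipschitzSet S)
    (hgen : ∀ b, upperGammaGenerator S (u b) ≤ upperGammaGenerator T (u b))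
    (t : ℝ≥0) (x : X) : val S t f x ≤ val T t f x := by
  have hf := hg.mem_lipschitzSet hκ hT
  have hgu : MixedTendsto (orbitQuotient f u) (𝓝[>] 0) g := by
    obtain ⟨u', hu', hg'⟩ := hg
    rw [hu.unique hu']
    exact hg'
  obtain ⟨C, hC0, hC⟩ := hu.exists_lipschitz hκ_cont hκ hT hf (t + 1)
  obtain ⟨R, hR0, hR⟩ := hu.exists_bddK hκ hT (t + 1)
  obtain ⟨K, hK0, hK⟩ := hS.exists_lipschitz hκ_cont hκ R t
  have hx := hκ x
  have hr_le : ∀ {r : ℝ}, r ≤ t → r.toNNReal ≤ t := fun h => Real.toNNReal_le_iff_le_coe.2 h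
  -- `le_antidiagonal` asks for a Lipschitz bound in all real b, whereas the orbit bounds hold on
  -- [0, t + 1]. Clamping is 1-Lipschitz and changes nothing for b in [0, t + 1].
  let clamp : ℝ → ℝ≥0 := fun b => min b.toNNReal (t + 1)
  have hclamp : ∀ b, clamp b ≤ t + 1 := fun b => min_le_right _ _
  have hclamp_eq : ∀ b : ℝ, b < t + 1 → clamp b = b.toNNReal := fun b hb =>
    min_eq_left (Real.toNNReal_le_iff_le_coe.2 (by push_cast; exact hb.le))
  have hclamp_lip : ∀ b b', |(clamp b : ℝ) - clamp b'| ≤ |b - b'| := fun b b' => by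
    have h1 := abs_min_sub_min_le_max (max b 0) ((t : ℝ) + 1) (max b' 0) (t + 1)
    have h2 := abs_max_sub_max_le_max b 0 b' 0
    simp only [sub_self, abs_zero, abs_nonneg, sup_of_le_left] at h1 h2
    have h3 : ∀ b, (clamp b : ℝ) = min (max b 0) (t + 1) := fun b => by
      simp [clamp, Real.coe_toNNReal']
    rw [h3, h3]
    exact h1.trans h2
  have key := le_antidiagonal (F := fun r b => val S r.toNNReal (u (clamp b)) x) (t := t)
    (C := K * C / κ x) t.coe_nonneg (by positivity)
    (fun r hr hrt b b' => by
      have h1 : ∀ b b', val S r.toNNReal (u (clamp b)) x - val S r.toNNReal (u (clamp b')) x ≤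
          K * C / κ x * |b - b'| := fun b b' => by
        refine (hK _ (hr_le hrt) _ _ (hR _ (hclamp b)) (hR _ (hclamp b'))
          (C * |b - b'|) (by positivity) (fun y => ?_) x).trans (le_of_eq (by ring))
        refine (le_abs_self _).trans ((hC _ _ (hclamp b) (hclamp b') y).trans ?_)
        exact div_le_div_of_nonneg_right (mul_le_mul_of_nonneg_left (hclamp_lip b b') hC0)
          (hκ y).le
      refine abs_le.2 ⟨?_, h1 b b'⟩
      have := h1 b' b
      rw [abs_sub_comm] at this
      linarith)
    (fun b => by
      obtain ⟨⟨v, hv⟩, h₀, hh₀, c, hc⟩ := hub (clamp b)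
      obtain ⟨R', hR'0, hR'⟩ := hv.exists_bddK hκ hS h₀
      obtain ⟨K', hK'0, hK'⟩ := hS.exists_lipschitz hκ_cont hκ R' t
      refine ⟨h₀, hh₀, K' * c / κ x, by positivity, fun r h hr hh hh1 hrh => ?_⟩
      have hh2 : h.toNNReal ≤ h₀ := Real.toNNReal_le_iff_le_coe.2 hh1
      have h1 := hK' r.toNNReal (hr_le (by linarith)) (v h.toNNReal) (u (clamp b)) (hR' _ hh2)
        (hv.apply_zero hκ hS ▸ hR' 0 zero_le) (c * h) (by positivity) (fun y => by
          have := val_sub_le_of_normK hκ hS (hc _ hh2) y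
          rwa [hv.val_eq hκ hS, NNReal.coe_mul, Real.coe_toNNReal h hh] at this) x
      rw [hv.val_orbit hκ hS, ← hv.val_eq hκ hS, ← Real.toNNReal_add hr hh] at h1
      calc _ ≤ val S r.toNNReal (u (clamp b)) x + K' * (c * h) / κ x := by linarith
        _ = _ := by ring)
    (fun r hr hrt b hb hbt ε hε => by
      have h1 := eventually_increment_le hκ_cont hκ hS hT hu hgu hf b.toNNReal (hub _) (hgen _)
        r.toNNReal x hε
      have h2 : Tendsto Real.toNNReal (𝓝[>] 0) (𝓝[>] 0) := by
        refine tendsto_nhdsWithin_iff.2 ⟨?_, ?_⟩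
        · have := (continuous_real_toNNReal.tendsto 0).mono_left
            (nhdsWithin_le_nhds (s := Set.Ioi (0 : ℝ)))
          rwa [Real.toNNReal_zero] at this
        · filter_upwards [self_mem_nhdsWithin] with h hh
          exact Real.toNNReal_pos.2 hh
      filter_upwards [h2.eventually h1, Ioo_mem_nhdsGT (sub_pos.2 hbt)] with h h3 h4
      rw [← Real.toNNReal_add hr h4.1.le, ← Real.toNNReal_add hb h4.1.le,
        Real.coe_toNNReal h h4.1.le] at h3
      rw [hclamp_eq b hbt, hclamp_eq (b + h) (by linarith [h4.2])]
      exact h3)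
  have h0 : clamp 0 = 0 := by simp [clamp]
  have ht : clamp t = t := by simp [clamp]
  rw [h0, ht, hu.apply_zero hκ hT, Real.toNNReal_coe, Real.toNNReal_zero, hS.val_zero hκ] at key
  rwa [hu.val_eq hκ hT]

theorem le_of_forall_val_le (hκ : ∀ x, 0 < κ x) (hS : IsConvexMonotoneFamily κ S)
    (hT : IsConvexMonotoneFamily κ T) {t : ℝ≥0} (h : ∀ x, val S t f x ≤ val T t f x) :
    (S t f).1 ≤ (T t f).1 := fun x => by
  rw [← hS.coe_val hκ, ← hT.coe_val hκ]
  exact EReal.coe_le_coe_iff.2 (h x)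

/-- Comparison on an invariant set. -/
theorem le_of_upperGammaGenerator_le (hκ_cont : Continuous κ) (hκ : ∀ x, 0 < κ x)
    (hS : IsConvexMonotoneFamily κ S) (hT : IsConvexMonotoneFamily κ T) {D : Set (CK κ)}
    (hD : D ⊆ lipschitzSet T ∩ upperLipschitzSet S)
    (hinv : ∀ t, ∀ f ∈ D, ∃ g ∈ D, (T t f).1 = ckFn g)
    (hgen : ∀ f ∈ D, upperGammaGenerator S f ≤ upperGammaGenerator T f)
    (t : ℝ≥0) (f : CK κ) (hf : f ∈ D ∩ generatorDomain T) : (S t f).1 ≤ (T t f).1 := by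
  obtain ⟨hfD, g, hg⟩ := hf
  obtain ⟨u, hu⟩ := (hD hfD).1.1
  have huD : ∀ b, u b ∈ D := fun b => by
    obtain ⟨g', hg', h⟩ := hinv b f hfD
    rwa [ckFn_injective ((hu.1 b).symm.trans h)]
  exact le_of_forall_val_le hκ hS hT fun x => val_le_val_of_generator hκ_cont hκ hS hT hg hu
    (fun b => (hD (huD b)).2) (fun b => hgen _ (huD b)) t x

/-- Comparison on the domain of the generator, from the Lipschitz set. -/
theorem le_of_lipschitzSet_subset (hκ_cont : Continuous κ) (hκ : ∀ x, 0 < κ x)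
    (hS : IsConvexMonotoneFamily κ S) (hT : IsConvexMonotoneFamily κ T)
    (hsub : lipschitzSet T ⊆ upperLipschitzSet S)
    (hgen : ∀ f ∈ lipschitzSet T, upperGammaGenerator S f ≤ upperGammaGenerator T f)
    (t : ℝ≥0) {f : CK κ} (hf : f ∈ generatorDomain T) : (S t f).1 ≤ (T t f).1 := by
  -- The Lipschitz set is invariant because orbits starting in it are locally Lipschitz in time, and
  -- it contains the generator domain because mixed convergence bounds the difference quotients.
  refine le_of_upperGammaGenerator_le hκ_cont hκ hS hT (D := lipschitzSet T)
    (fun f hf => ⟨hf, hsub hf⟩) (fun t f hf => ?_) hgen t f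
    ⟨hf.choose_spec.mem_lipschitzSet hκ hT, hf⟩
  obtain ⟨u, hu⟩ := hf.1
  exact ⟨u t, hu.mem_lipschitzSet hκ_cont hκ hT hf t, hu.1 t⟩

theorem MixedTendsto.val_tendsto (hκ_cont : Continuous κ) (hκ : ∀ x, 0 < κ x)
    (hS : IsConvexMonotoneFamily κ S) {F : ℕ → CK κ} (hF : MixedTendsto F atTop f) (t : ℝ≥0)
    (x : X) : Tendsto (fun n => val S t (F n) x) atTop (𝓝 (val S t f x)) := by
  obtain ⟨R, -, hR⟩ := hF.exists_eventually_bddK hκ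
  exact (hS.isRealOp hκ t).tendsto hκ_cont hκ hR hF.tendsto_prod x

end Comparison

end ConvexMonotone

theorem theorem2p7 {X : Type*} [MetricSpace X] [CompleteSpace X]
    [TopologicalSpace.SeparableSpace X]
    (κ : X → ℝ) (hκ_cont : Continuous κ) (hκ_pos : ∀ x, 0 < κ x) (hκ_bdd : ∃ C, ∀ x, κ x ≤ C)
    (S T : ℝ≥0 → CK κ → UK κ)
    (hS : IsConvexMonotoneFamily κ S) (hT : IsConvexMonotoneFamily κ T) :
    -- comparison
    (∀ D : Set (CK κ), D ⊆ lipschitzSet T ∩ upperLipschitzSet S →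
      (∀ t, ∀ f ∈ D, ∃ g ∈ D, (T t f).1 = ckFn g) →
      (∀ f ∈ D, upperGammaGenerator S f ≤ upperGammaGenerator T f) →
      ∀ t, ∀ f ∈ D ∩ generatorDomain T, (S t f).1 ≤ (T t f).1) ∧
    -- uniqueness
    (lipschitzSet T ⊆ upperLipschitzSet S → lipschitzSet S ⊆ upperLipschitzSet T →
      (∀ f ∈ lipschitzSet S ∪ lipschitzSet T,
        upperGammaGenerator S f = upperGammaGenerator T f) →
      ∀ (F : ℕ → CK κ) (f : CK κ), (∀ n, F n ∈ generatorDomain S ∩ generatorDomain T) →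
        MixedTendsto F atTop f → ∀ t, S t f = T t f) := by
  refine ⟨fun D hD hinv hgen t f hf =>
    le_of_upperGammaGenerator_le hκ_cont hκ_pos hS hT hD hinv hgen t f hf,
    fun hTS hST hgen F f hF hlim t => Subtype.ext ?_⟩
  have hval : ∀ n x, val S t (F n) x = val T t (F n) x := fun n x => by
    have h1 := le_of_lipschitzSet_subset hκ_cont hκ_pos hS hT hTS
      (fun f hf => (hgen f (Or.inr hf)).le) t (hF n).2
    have h2 := le_of_lipschitzSet_subset hκ_cont hκ_pos hT hS hST
      (fun f hf => (hgen f (Or.inl hf)).ge) t (hF n).1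
    rw [val, val, le_antisymm h1 h2]
  funext x
  rw [← hS.coe_val hκ_pos, ← hT.coe_val hκ_pos]
  refine congrArg _ (tendsto_nhds_unique (hlim.val_tendsto hκ_cont hκ_pos hS t x) ?_)
  simp only [hval]
  exact hlim.val_tendsto hκ_cont hκ_pos hT t x
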